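/- Let $N\in\mathbb N=\{1,2,\dots\}$, $p\in[2,\infty)$, $q\in[1,\infty)$ with \[ \tfrac1p\Bigl(1-\tfrac1{2q}\Bigr)\ \ge\ \tfrac12-\tfrac1N , \] and let $V:\mathbb R^N\to\mathbb R$ be a measurable function with $V^+=\max(V,0)\in L^q(\mathbb R^N)$ (for instance $V\in L^q(\mathbb R^N)$). Let $u\in H^1(\mathbb R^N)$ be a real-valued weak solution of the Choquard equation \[ -\Delta u+u=(V*|u|^p)\,|u|^{p-2}u\qquad\text{in }\mathbb R^N, \] in the following local sense: the right-hand side $f=(V*|u|^p)|u|^{p-2}u$ is a well-defined function belonging to $H^{-1}_{\mathrm{loc}}(\mathbb R^N)$ (that is, the integral defining $(V*|u|^p)(x)$ converges absolutely for almost every $x$ with $u(x)\neq0$, with $f=0$ where $u=0$; $f$ is locally integrable; and for every compact set $K$ the functional $\psi\mapsto\int f\psi$ is bounded in the $H^1$ norm on smooth functions supported in $K$), and for every $\varphi\in H^1(\mathbb R^N)$ with compact support \[ \int_{\mathbb R^N}\nabla u\cdot\nabla\varphi+u\,\varphi=\int_{\mathbb R^N}(V*|u|^p)\,|u|^{p-2}u\,\varphi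 , \] where the right-hand integral is understood as the duality product between $H^{-1}_{\mathrm{loc}}$ and compactly supported $H^1$ functions, i.e. as $\lim_n\int f\psi_n$ for $\psi_n\in C^\infty_c(\mathbb R^N)$ supported in a common compact set and converging to $\varphi$ in $H^1$. Then \[ \int_{\mathbb R^N}\bigl(|V|*|u|^p\bigr)\,|u|^p<+\infty \qquad\text{and}\qquad \int_{\mathbb R^N}(V*|u|^p)\,|u|^p=\int_{\mathbb R^N}\bigl(|\nabla u|^2+|u|^2\bigr). \] -/

import Mathlib

open MeasureTheory Filter Topology
open scoped ENNReal ContDiff Convolution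

noncomputable section

namespace Choquard

/-- The Euclidean space `ℝ^N`. -/
abbrev Eucl (N : ℕ) : Type := EuclideanSpace ℝ (Fin N)

/-- Test functions: `ψ ∈ C_c^∞(ℝ^N)`. -/
def IsTest {N : ℕ} (ψ : Eucl N → ℝ) : Prop :=
  ContDiff ℝ ∞ ψ ∧ HasCompactSupport ψ

/-- `g` is the weak (distributional) gradient of `u`: both are locally integrable and
`∫ u ∂ᵢψ = - ∫ gᵢ ψ` for every test function `ψ` and every coordinate `i`. -/
def HasWeakGradient {N : ℕ} (u : Eucl N → ℝ) (g : Eucl N → Eucl N) : Prop :=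
  LocallyIntegrable u volume ∧ LocallyIntegrable g volume ∧
    ∀ ψ : Eucl N → ℝ, IsTest ψ → ∀ i : Fin N,
      ∫ x, u x * fderiv ℝ ψ x (EuclideanSpace.single i 1) = - ∫ x, g x i * ψ x

/-- The weak gradient is unique up to a set of measure zero. -/
theorem HasWeakGradient.ae_unique {N : ℕ} {u : Eucl N → ℝ} {g h : Eucl N → Eucl N}
    (hg : HasWeakGradient u g) (hh : HasWeakGradient u h) : g =ᵐ[volume] h := by
  have key : ∀ i : Fin N, ∀ᵐ x ∂(volume : Measure (Eucl N)), g x i = h x i := by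
    intro i
    have hloc : ∀ k : Eucl N → Eucl N, LocallyIntegrable k volume →
        LocallyIntegrable (fun x => k x i) volume := by
      intro k hk x
      obtain ⟨s, hs, hint⟩ := hk x
      exact ⟨s, hs, (EuclideanSpace.proj i : Eucl N →L[ℝ] ℝ).integrable_comp hint⟩
    refine ae_eq_of_integral_contDiff_smul_eq (hloc g hg.2.1) (hloc h hh.2.1) ?_
    intro ψ hψ hc
    have h1 := hg.2.2 ψ ⟨hψ, hc⟩ i
    have h2 := hh.2.2 ψ ⟨hψ, hc⟩ i
    simp only [smul_eq_mul, mul_comm (ψ _)]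
    linarith
  filter_upwards [ae_all_iff.2 key] with x hx
  ext i
  exact hx i

open Classical in
/-- The weak gradient `∇u` (a representative, unique almost everywhere); it is only used for
functions that have one. -/
def weakGrad {N : ℕ} (u : Eucl N → ℝ) : Eucl N → Eucl N :=
  if h : ∃ g, HasWeakGradient u g then h.choose else 0

theorem HasWeakGradient.weakGrad {N : ℕ} {u : Eucl N → ℝ} {g : Eucl N → Eucl N}
    (hg : HasWeakGradient u g) : HasWeakGradient u (weakGrad u) := by
  have h : ∃ g, HasWeakGradient u g := ⟨g, hg⟩
  rw [Choquard.weakGrad, dif_pos h]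
  exact h.choose_spec

theorem HasWeakGradient.weakGrad_ae_eq {N : ℕ} {u : Eucl N → ℝ} {g : Eucl N → Eucl N}
    (hg : HasWeakGradient u g) : Choquard.weakGrad u =ᵐ[volume] g :=
  hg.weakGrad.ae_unique hg

/-- `u ∈ H¹(ℝ^N)`: `u` is square-integrable and has a square-integrable weak gradient. -/
def MemH1 {N : ℕ} (u : Eucl N → ℝ) : Prop :=
  MemLp u 2 volume ∧ (∃ g, HasWeakGradient u g) ∧ MemLp (weakGrad u) 2 volume

/-- `u ∈ H¹_loc(ℝ^N)`. -/
def MemH1Loc {N : ℕ} (u : Eucl N → ℝ) : Prop :=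
  (∃ g, HasWeakGradient u g) ∧ ∀ K : Set (Eucl N), IsCompact K →
    MemLp u 2 (volume.restrict K) ∧ MemLp (weakGrad u) 2 (volume.restrict K)

/-- The `H¹` norm `(∫ |∇φ|² + |φ|²)^{1/2}` of `φ ∈ H¹(ℝ^N)`. -/
def h1Norm {N : ℕ} (φ : Eucl N → ℝ) : ℝ :=
  Real.sqrt (∫ x, (‖weakGrad φ x‖ ^ 2 + |φ x| ^ 2))

/-- The function `f` belongs to `H⁻¹_loc(ℝ^N)`: it is locally integrable (so that it is a
distribution) and for each compact `K` the functional `ψ ↦ ∫ f ψ` is bounded for the `H¹` norm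
on the test functions supported in `K`. -/
def MemHMinusOneLoc {N : ℕ} (f : Eucl N → ℝ) : Prop :=
  LocallyIntegrable f volume ∧ ∀ K : Set (Eucl N), IsCompact K → ∃ C : ℝ,
    ∀ ψ : Eucl N → ℝ, IsTest ψ → tsupport ψ ⊆ K → |∫ x, f x * ψ x| ≤ C * h1Norm ψ

/-- For `f ∈ H⁻¹_loc(ℝ^N)` and a compactly supported `φ ∈ H¹(ℝ^N)`, the number `ℓ` is the value
of `∫ f φ`, understood as the duality product of `f` and `φ`: it is the limit of `∫ f ψₙ` whenever
the test functions `ψₙ`, with supports in a common compact set, converge to `φ` in `H¹`. -/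
def IsDualityProduct {N : ℕ} (f φ : Eucl N → ℝ) (ℓ : ℝ) : Prop :=
  ∀ (ψ : ℕ → Eucl N → ℝ) (K : Set (Eucl N)), IsCompact K →
    (∀ n, IsTest (ψ n) ∧ tsupport (ψ n) ⊆ K) →
    Tendsto (fun n => h1Norm (fun x => ψ n x - φ x)) atTop (𝓝 0) →
    Tendsto (fun n => ∫ x, f x * ψ n x) atTop (𝓝 ℓ)

/-- The convolution `V ∗ |u|^p`, that is `x ↦ ∫ V(t) |u(x - t)|^p dt`. -/
def potential {N : ℕ} (V : Eucl N → ℝ) (p : ℝ) (u : Eucl N → ℝ) : Eucl N → ℝ :=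
  V ⋆[ContinuousLinearMap.mul ℝ ℝ, volume] (fun x => |u x| ^ p)

/-- The nonlinearity `(V ∗ |u|^p) |u|^{p-2} u`. -/
def nonlinearity {N : ℕ} (V : Eucl N → ℝ) (p : ℝ) (u : Eucl N → ℝ) : Eucl N → ℝ :=
  fun x => potential V p u x * |u x| ^ (p - 2) * u x

/-- `u ∈ H¹_loc(ℝ^N)` is a weak solution of `-Δu + u = (V ∗ |u|^p) |u|^{p-2} u`: the right-hand
side is a function in `H⁻¹_loc` (in particular the convolution integral converges absolutely at
almost every point where `u` does not vanish; where `u = 0` the right-hand side is `0`), and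
`∫ ∇u · ∇φ + u φ = ∫ (V ∗ |u|^p) |u|^{p-2} u φ` for every compactly supported `φ ∈ H¹(ℝ^N)`. -/
def IsWeakSolution {N : ℕ} (V : Eucl N → ℝ) (p : ℝ) (u : Eucl N → ℝ) : Prop :=
  MemH1Loc u ∧
  (∀ᵐ x ∂(volume : Measure (Eucl N)), u x ≠ 0 →
    ConvolutionExistsAt V (fun y => |u y| ^ p) x (ContinuousLinearMap.mul ℝ ℝ) volume) ∧
  MemHMinusOneLoc (nonlinearity V p u) ∧
  ∀ φ : Eucl N → ℝ, MemH1 φ → HasCompactSupport φ →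
    IsDualityProduct (nonlinearity V p u) φ
      (∫ x, (inner ℝ (weakGrad u x) (weakGrad φ x) + u x * φ x))

end Choquard

end

/-! Testing the equation with `u` itself would give the identity, but the right-hand side `f` is
only in `H⁻¹_loc`, so neither `u` as a test function nor the integrability of `f u` is available at
once. Instead the equation is tested with `truncCutoff n u`, a cutoff times a smooth bounded
truncation of `u`. This function is bounded and compactly supported, so its duality product with `f`
is a genuine integral (`IsDualityProduct.eq_integral`). The truncation is `u` times a weight, so
this integral is `∫ S θₙ` with `S = (V ∗ |u|^p)|u|^p`, `0 ≤ θₙ ≤ 1` and `θₙ → 1`. The left-hand side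
converges to `∫ |∇u|² + u²` by dominated convergence.

The limit of `∫ S θₙ` needs control of `S` from one side only: `S ≤ H`, where `H = (V⁺ ∗
|u|^p)|u|^p`. The exponent condition says exactly that Sobolev's embedding puts `|u|^p` in `L^r`
with `1/r = 1 - 1/(2q)` (`HasWeakGradient.lintegral_rpow_lt_top`), and Young's inequality then makes
`H` integrable (`lintegral_lconvolution_mul_lt_top`). Fatou's lemma for `H - S θₙ ≥ 0` gives the
integrability of `S`, after which dominated convergence identifies `∫ S`
(`integrable_of_tendsto_integral_mul`). Finally `|V| = 2V⁺ - V` turns the integrability of `H` and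
`S` into the finiteness claim. -/

noncomputable section

namespace Choquard

/-! ### Mollification and its convergence in `L²`. -/

/-- A shrinking family of bump functions centred at the origin. -/
def bump (N n : ℕ) : ContDiffBump (0 : Eucl N) where
  rIn := 1 / ((n : ℝ) + 1)
  rOut := 2 / ((n : ℝ) + 1)
  rIn_pos := by positivity
  rIn_lt_rOut := by gcongr; norm_num

/-- The mollification of `g` at scale `1 / (n + 1)`. -/
def mollify {N : ℕ} {F : Type*} [NormedAddCommGroup F] [NormedSpace ℝ F] (n : ℕ)
    (g : Eucl N → F) : Eucl N → F :=
  (bump N n).normed volume ⋆[ContinuousLinearMap.lsmul ℝ ℝ, volume] g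

section Mollify

variable {N : ℕ} {F : Type*} [NormedAddCommGroup F] [NormedSpace ℝ F]

theorem bump_rOut_tendsto (N : ℕ) : Tendsto (fun n => (bump N n).rOut) atTop (𝓝 0) := by
  have h := (tendsto_one_div_add_atTop_nhds_zero_nat (𝕜 := ℝ)).const_mul 2
  simp only [mul_zero] at h
  refine h.congr fun n => ?_
  simp only [bump]
  ring

theorem bump_rOut_le (N n : ℕ) : (bump N n).rOut ≤ 2 := by
  simp only [bump]
  rw [div_le_iff₀ (by positivity)]
  have : (0 : ℝ) ≤ n := by positivity
  linarith

theorem mollify_apply (n : ℕ) (g : Eucl N → F) (x : Eucl N) :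
    mollify n g x = ∫ t, (bump N n).normed volume t • g (x - t) := rfl

theorem mollify_tendsto_ae [CompleteSpace F] {g : Eucl N → F} (hg : LocallyIntegrable g volume) :
    ∀ᵐ x, Tendsto (fun n => mollify n g x) atTop (𝓝 (g x)) := by
  -- `K = 2` is the fixed ratio `rOut / rIn`, which keeps the kernels comparable to averages over
  -- balls.
  refine ContDiffBump.ae_convolution_tendsto_right_of_locallyIntegrable (K := 2)
    (bump_rOut_tendsto N) (Eventually.of_forall fun n => ?_) hg
  simp only [bump]
  apply le_of_eq
  ring

theorem lintegral_bump (n : ℕ) : ∫⁻ t, ‖(bump N n).normed volume t‖ₑ = 1 := by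
  rw [← ofReal_integral_norm_eq_lintegral_enorm (bump N n).integrable_normed]
  simp only [Real.norm_of_nonneg ((bump N n).nonneg_normed _), (bump N n).integral_normed,
    ENNReal.ofReal_one]

/-- Cauchy–Schwarz for `√w` and `√w G`. When `w` has mass one this is Jensen's inequality for the
square. -/
theorem sq_lintegral_mul_le {α : Type*} [MeasurableSpace α] {μ : Measure α} {w G : α → ℝ≥0∞}
    (hw : AEMeasurable w μ) (hG : AEMeasurable G μ) :
    (∫⁻ t, w t * G t ∂μ) ^ 2 ≤ (∫⁻ t, w t ∂μ) * ∫⁻ t, w t * G t ^ 2 ∂μ := by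
  have h := ENNReal.lintegral_mul_le_Lp_mul_Lq μ Real.HolderConjugate.two_two
    (f := fun t => w t ^ (1 / 2 : ℝ)) (g := fun t => w t ^ (1 / 2 : ℝ) * G t)
    (hw.pow_const _) ((hw.pow_const _).mul hG)
  have e1 : ∀ t, (w t ^ (1 / 2 : ℝ)) ^ (2 : ℝ) = w t := fun t => by
    rw [← ENNReal.rpow_mul]; norm_num
  have e2 : ∀ t, w t ^ (1 / 2 : ℝ) * (w t ^ (1 / 2 : ℝ) * G t) = w t * G t := fun t => by
    rw [← mul_assoc, ← ENNReal.rpow_add_of_nonneg _ _ (by norm_num) (by norm_num)]; norm_num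
  simp only [Pi.mul_apply, e2, ENNReal.mul_rpow_of_nonneg _ _ (zero_le_two (α := ℝ)), e1] at h
  refine (pow_le_pow_left' h 2).trans (le_of_eq ?_)
  rw [mul_pow]
  simp only [← ENNReal.rpow_natCast, ← ENNReal.rpow_mul]
  norm_num

/-- Jensen's inequality against the kernel, which has mass one, followed by Tonelli and translation
invariance. -/
theorem lintegral_mollify_sq_le (n : ℕ) {g : Eucl N → F} (hg : AEStronglyMeasurable g volume) :
    ∫⁻ x, ‖mollify n g x‖ₑ ^ 2 ≤ ∫⁻ x, ‖g x‖ₑ ^ 2 := by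
  have hρ : AEMeasurable (fun t => ‖(bump N n).normed volume t‖ₑ) volume :=
    (bump N n).continuous_normed.aestronglyMeasurable.enorm
  have hg' : AEMeasurable (fun p : Eucl N × Eucl N => ‖g (p.1 - p.2)‖ₑ)
      (volume.prod volume) :=
    (hg.comp_quasiMeasurePreserving (quasiMeasurePreserving_sub volume volume)).enorm
  have h1 : ∀ x, ‖mollify n g x‖ₑ ^ 2 ≤
      ∫⁻ t, ‖(bump N n).normed volume t‖ₑ * ‖g (x - t)‖ₑ ^ 2 := by
    intro x
    have hgx : AEMeasurable (fun t => ‖g (x - t)‖ₑ) volume :=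
      (hg.comp_quasiMeasurePreserving
        (Measure.measurePreserving_sub_left volume x).quasiMeasurePreserving).enorm
    refine (pow_le_pow_left' ((enorm_integral_le_lintegral_enorm _).trans ?_) 2).trans
      ((sq_lintegral_mul_le hρ hgx).trans_eq (by rw [lintegral_bump, one_mul]))
    simp [enorm_smul]
  calc ∫⁻ x, ‖mollify n g x‖ₑ ^ 2
      ≤ ∫⁻ x, ∫⁻ t, ‖(bump N n).normed volume t‖ₑ * ‖g (x - t)‖ₑ ^ 2 := lintegral_mono h1
    _ = ∫⁻ t, ∫⁻ x, ‖(bump N n).normed volume t‖ₑ * ‖g (x - t)‖ₑ ^ 2 := by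
        refine lintegral_lintegral_swap ?_
        exact ((bump N n).continuous_normed.aestronglyMeasurable.enorm.comp_quasiMeasurePreserving
          Measure.quasiMeasurePreserving_snd).mul (hg'.pow_const 2)
    _ = ∫⁻ t, ‖(bump N n).normed volume t‖ₑ * ∫⁻ x, ‖g x‖ₑ ^ 2 := by
        congr 1
        ext t
        rw [lintegral_const_mul' _ _ enorm_ne_top,
          lintegral_sub_right_eq_self (fun x => ‖g x‖ₑ ^ 2) t]
    _ = ∫⁻ x, ‖g x‖ₑ ^ 2 := by
        rw [lintegral_mul_const'' _ hρ, lintegral_bump, one_mul]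

theorem mollify_contDiff (n : ℕ) {g : Eucl N → F} (hg : LocallyIntegrable g volume) :
    ContDiff ℝ ∞ (mollify n g) :=
  (bump N n).hasCompactSupport_normed.contDiff_convolution_left _ (bump N n).contDiff_normed hg

/-- A bounded sequence in `L²` that converges almost everywhere to a function with at least as
large a norm converges strongly. -/
theorem lintegral_enorm_sub_sq_tendsto_zero {α H : Type*} [MeasurableSpace α] {μ : Measure α}
    [NormedAddCommGroup H] [InnerProductSpace ℝ H] {f : ℕ → α → H} {g : α → H}
    (hf : ∀ n, AEStronglyMeasurable (f n) μ) (hg : AEStronglyMeasurable g μ)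
    (hle : ∀ n, ∫⁻ x, ‖f n x‖ₑ ^ 2 ∂μ ≤ ∫⁻ x, ‖g x‖ₑ ^ 2 ∂μ)
    (hfin : ∫⁻ x, ‖g x‖ₑ ^ 2 ∂μ ≠ ⊤)
    (hlim : ∀ᵐ x ∂μ, Tendsto (fun n => f n x) atTop (𝓝 (g x))) :
    Tendsto (fun n => ∫⁻ x, ‖f n x - g x‖ₑ ^ 2 ∂μ) atTop (𝓝 0) := by
  set G := ∫⁻ x, ‖g x‖ₑ ^ 2 ∂μ with hG
  -- By the parallelogram law the squared norms of `fₙ + g` and `fₙ - g` sum to at most `4G`.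
  -- Fatou's lemma forces the first to be at least `4G` in the limit, so the second tends to zero.
  have hpar : ∀ a b : H, ‖a + b‖ₑ ^ 2 + ‖a - b‖ₑ ^ 2 = 2 * ‖a‖ₑ ^ 2 + 2 * ‖b‖ₑ ^ 2 := by
    intro a b
    have := parallelogram_law_with_norm ℝ a b
    simp only [← ofReal_norm]
    rw [← ENNReal.ofReal_pow (norm_nonneg _), ← ENNReal.ofReal_pow (norm_nonneg _),
      ← ENNReal.ofReal_pow (norm_nonneg _), ← ENNReal.ofReal_pow (norm_nonneg _),
      ← ENNReal.ofReal_add (by positivity) (by positivity),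
      show (2 : ℝ≥0∞) = ENNReal.ofReal 2 by simp,
      ← ENNReal.ofReal_mul (by norm_num), ← ENNReal.ofReal_mul (by norm_num),
      ← ENNReal.ofReal_add (by positivity) (by positivity)]
    congr 1
    nlinarith
  have hsum : ∀ n, ∫⁻ x, ‖f n x + g x‖ₑ ^ 2 ∂μ + ∫⁻ x, ‖f n x - g x‖ₑ ^ 2 ∂μ ≤ 4 * G := by
    intro n
    have hm : AEMeasurable (fun x => ‖f n x + g x‖ₑ ^ 2) μ := ((hf n).add hg).enorm.pow_const 2
    rw [← lintegral_add_left' hm]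
    simp only [hpar]
    rw [lintegral_add_left' (((hf n).enorm.pow_const 2).const_mul 2),
      lintegral_const_mul'' _ ((hf n).enorm.pow_const 2),
      lintegral_const_mul'' _ (hg.enorm.pow_const 2), ← hG]
    calc _ ≤ 2 * G + 2 * G := by gcongr; exact hle n
      _ = 4 * G := by rw [← add_mul]; norm_num
  have hfatou : 4 * G ≤ liminf (fun n => ∫⁻ x, ‖f n x + g x‖ₑ ^ 2 ∂μ) atTop := by
    refine le_trans (le_of_eq ?_) (lintegral_liminf_le' (f := fun n x => ‖f n x + g x‖ₑ ^ 2)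
      fun n => ((hf n).add hg).enorm.pow_const 2)
    rw [hG, ← lintegral_const_mul'' _ (hg.enorm.pow_const 2)]
    refine lintegral_congr_ae ?_
    filter_upwards [hlim] with x hx
    have h1 : Tendsto (fun n => ‖f n x + g x‖ₑ ^ 2) atTop (𝓝 (‖g x + g x‖ₑ ^ 2)) :=
      (ENNReal.continuous_pow 2).continuousAt.tendsto.comp ((hx.add_const (g x)).enorm)
    have h2 := h1.liminf_eq
    rw [h2]
    have := hpar (g x) (g x)
    simp only [sub_self, enorm_zero, ne_eq, OfNat.ofNat_ne_zero, not_false_eq_true, zero_pow,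
      add_zero] at this
    rw [this, ← add_mul]
    norm_num
  have hA : Tendsto (fun n => ∫⁻ x, ‖f n x + g x‖ₑ ^ 2 ∂μ) atTop (𝓝 (4 * G)) :=
    tendsto_of_le_liminf_of_limsup_le hfatou
      ((limsup_le_limsup (Eventually.of_forall fun n => le_self_add.trans (hsum n))).trans
        (le_of_eq (limsup_const _)))
  have h4 : 4 * G ≠ ⊤ := ENNReal.mul_ne_top (by norm_num) hfin
  have hB := ENNReal.Tendsto.sub (tendsto_const_nhds (x := 4 * G)) hA (Or.inl h4)
  rw [tsub_self] at hB
  refine tendsto_of_tendsto_of_tendsto_of_le_of_le tendsto_const_nhds hB (fun _ => zero_le)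
    fun n => ?_
  refine ENNReal.le_sub_of_add_le_left ?_ (hsum n)
  exact ne_top_of_le_ne_top h4 (le_self_add.trans (hsum n))

theorem _root_.MeasureTheory.MemLp.lintegral_enorm_sq_lt_top {α E : Type*} [MeasurableSpace α]
    {μ : Measure α} [NormedAddCommGroup E] {g : α → E} (hg : MemLp g 2 μ) :
    ∫⁻ x, ‖g x‖ₑ ^ 2 ∂μ < ⊤ := by
  have := lintegral_rpow_enorm_lt_top_of_eLpNorm_lt_top two_ne_zero ENNReal.ofNat_ne_top hg.2
  simpa using this

theorem memLp_two_of_lintegral {α E : Type*} [MeasurableSpace α]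
    {μ : Measure α} [NormedAddCommGroup E] {g : α → E} (hm : AEStronglyMeasurable g μ)
    (hg : ∫⁻ x, ‖g x‖ₑ ^ 2 ∂μ < ⊤) : MemLp g 2 μ := by
  refine ⟨hm, ?_⟩
  rw [eLpNorm_lt_top_iff_lintegral_rpow_enorm_lt_top two_ne_zero ENNReal.ofNat_ne_top]
  simpa using hg

theorem _root_.MeasureTheory.MemLp.locallyIntegrable_two {E : Type*} [NormedAddCommGroup E]
    {g : Eucl N → E} (hg : MemLp g 2 volume) : LocallyIntegrable g volume :=
  hg.locallyIntegrable (by norm_num)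

theorem mollify_tendsto_L2 {H : Type*} [NormedAddCommGroup H] [InnerProductSpace ℝ H]
    [CompleteSpace H] {g : Eucl N → H} (hg : MemLp g 2 volume) :
    Tendsto (fun n => ∫⁻ x, ‖mollify n g x - g x‖ₑ ^ 2) atTop (𝓝 0) :=
  lintegral_enorm_sub_sq_tendsto_zero
    (fun n => (mollify_contDiff n hg.locallyIntegrable_two).continuous.aestronglyMeasurable)
    hg.1 (fun n => lintegral_mollify_sq_le n hg.1) hg.lintegral_enorm_sq_lt_top.ne
    (mollify_tendsto_ae hg.locallyIntegrable_two)

theorem norm_mollify_le (n : ℕ) {g : Eucl N → F} {C : ℝ} (hg : ∀ x, ‖g x‖ ≤ C) (x : Eucl N) :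
    ‖mollify n g x‖ ≤ C := by
  have h := norm_integral_le_of_norm_le ((bump N n).integrable_normed.mul_const C)
    (Eventually.of_forall fun t => (by
      rw [norm_smul, Real.norm_of_nonneg ((bump N n).nonneg_normed _)]
      exact mul_le_mul_of_nonneg_left (hg (x - t)) ((bump N n).nonneg_normed _) :
      ‖(bump N n).normed volume t • g (x - t)‖ ≤ (bump N n).normed volume t * C))
  rwa [integral_mul_const, (bump N n).integral_normed, one_mul] at h

/-- The radius `2` bounds `rOut` for every `n`, so all mollifications of a compactly supported
function live in one compact set, as `IsDualityProduct` demands. -/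
theorem tsupport_mollify_subset (n : ℕ) (g : Eucl N → F) :
    tsupport (mollify n g) ⊆ Metric.cthickening 2 (tsupport g) := by
  refine closure_minimal ?_ Metric.isClosed_cthickening
  refine (support_convolution_subset_swap _).trans ?_
  rintro _ ⟨a, ha, b, hb, rfl⟩
  rw [(bump N n).support_normed_eq] at hb
  refine Metric.mem_cthickening_of_dist_le _ a 2 _ (subset_tsupport g ha) ?_
  have hb' := (mem_ball_zero_iff.1 hb).le.trans (bump_rOut_le N n)
  simpa [dist_eq_norm] using hb'

end Mollify

/-! ### Calculus of weak gradients: product rule, chain rule, approximation in `H¹`. -/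

section WeakGradient

variable {N : ℕ}

theorem IsTest.continuous {ψ : Eucl N → ℝ} (hψ : IsTest ψ) : Continuous ψ := hψ.1.continuous

theorem IsTest.continuous_fderiv_apply {ψ : Eucl N → ℝ} (hψ : IsTest ψ) (v : Eucl N) :
    Continuous fun x => fderiv ℝ ψ x v :=
  (hψ.1.continuous_fderiv (by simp)).clm_apply continuous_const

theorem IsTest.hasCompactSupport_fderiv_apply {ψ : Eucl N → ℝ} (hψ : IsTest ψ) (v : Eucl N) :
    HasCompactSupport fun x => fderiv ℝ ψ x v :=
  hψ.2.fderiv_apply ℝ v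

theorem IsTest.mul_left {χ ψ : Eucl N → ℝ} (hχ : ContDiff ℝ ∞ χ) (hψ : IsTest ψ) :
    IsTest fun x => χ x * ψ x :=
  ⟨hχ.mul hψ.1, hψ.2.mul_left⟩

theorem IsTest.comp_sub_left {ψ : Eucl N → ℝ} (hψ : IsTest ψ) (x : Eucl N) :
    IsTest fun y => ψ (x - y) :=
  ⟨hψ.1.comp (contDiff_const.sub contDiff_id),
    hψ.2.comp_homeomorph (Homeomorph.subLeft x)⟩

theorem isTest_bump (n : ℕ) : IsTest ((bump N n).normed volume) :=
  ⟨(bump N n).contDiff_normed, (bump N n).hasCompactSupport_normed⟩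

theorem _root_.MeasureTheory.LocallyIntegrable.coord {k : Eucl N → Eucl N}
    (hk : LocallyIntegrable k volume) (i : Fin N) :
    LocallyIntegrable (fun x => k x i) volume := by
  intro x
  obtain ⟨s, hs, hint⟩ := hk x
  exact ⟨s, hs, (EuclideanSpace.proj i : Eucl N →L[ℝ] ℝ).integrable_comp hint⟩

theorem _root_.MeasureTheory.LocallyIntegrable.integrable_mul_of_compact {k ψ : Eucl N → ℝ}
    (hk : LocallyIntegrable k volume) (hψ : Continuous ψ) (hc : HasCompactSupport ψ) :
    Integrable (fun x => k x * ψ x) volume := by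
  have := hk.integrable_smul_left_of_hasCompactSupport hψ hc
  simpa only [smul_eq_mul, mul_comm] using this

theorem gradient_coord (χ : Eucl N → ℝ) (x : Eucl N) (i : Fin N) :
    gradient χ x i = fderiv ℝ χ x (EuclideanSpace.single i 1) := by
  have h : inner ℝ (EuclideanSpace.single i (1 : ℝ)) (gradient χ x) = gradient χ x i := by
    rw [EuclideanSpace.inner_single_left, map_one, one_mul]
  rw [← h, real_inner_comm, inner_gradient_left]

theorem norm_gradient (χ : Eucl N → ℝ) (x : Eucl N) : ‖gradient χ x‖ = ‖fderiv ℝ χ x‖ := by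
  simp [gradient]

theorem continuous_gradient {χ : Eucl N → ℝ} (hχ : ContDiff ℝ ∞ χ) : Continuous (gradient χ) :=
  (InnerProductSpace.toDual ℝ (Eucl N)).symm.continuous.comp (hχ.continuous_fderiv (by simp))

theorem integral_mul_fderiv_test {w ψ : Eucl N → ℝ} (hw : ContDiff ℝ 1 w) (hψ : IsTest ψ)
    (v : Eucl N) : ∫ x, w x * fderiv ℝ ψ x v = - ∫ x, fderiv ℝ w x v * ψ x := by
  have hw' : Continuous fun x => fderiv ℝ w x v :=
    (hw.continuous_fderiv one_ne_zero).clm_apply continuous_const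
  refine integral_mul_fderiv_eq_neg_fderiv_mul_of_integrable ?_ ?_ ?_
    (fun x _ => hw.differentiable one_ne_zero x) (fun x _ => hψ.1.differentiable (by simp) x)
  · exact (hw'.mul hψ.continuous).integrable_of_hasCompactSupport hψ.2.mul_left
  · exact (hw.continuous.mul (hψ.continuous_fderiv_apply v)).integrable_of_hasCompactSupport
      (hψ.hasCompactSupport_fderiv_apply v).mul_left
  · exact (hw.continuous.mul hψ.continuous).integrable_of_hasCompactSupport hψ.2.mul_left

theorem hasWeakGradient_gradient {w : Eucl N → ℝ} (hw : ContDiff ℝ ∞ w) :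
    HasWeakGradient w (gradient w) := by
  refine ⟨hw.continuous.locallyIntegrable, (continuous_gradient hw).locallyIntegrable,
    fun ψ hψ i => ?_⟩
  simp only [gradient_coord]
  exact integral_mul_fderiv_test (hw.of_le (by exact_mod_cast le_top)) hψ _

theorem HasWeakGradient.sub {u w : Eucl N → ℝ} {g h : Eucl N → Eucl N}
    (hu : HasWeakGradient u g) (hw : HasWeakGradient w h) :
    HasWeakGradient (fun x => u x - w x) (fun x => g x - h x) := by
  refine ⟨hu.1.sub hw.1, hu.2.1.sub hw.2.1, fun ψ hψ i => ?_⟩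
  have i1 := hψ.continuous_fderiv_apply (EuclideanSpace.single i 1)
  have i2 := hψ.hasCompactSupport_fderiv_apply (EuclideanSpace.single i 1)
  simp only [sub_mul, PiLp.sub_apply]
  rw [integral_sub (hu.1.integrable_mul_of_compact i1 i2) (hw.1.integrable_mul_of_compact i1 i2),
    integral_sub ((hu.2.1.coord i).integrable_mul_of_compact hψ.continuous hψ.2)
      ((hw.2.1.coord i).integrable_mul_of_compact hψ.continuous hψ.2),
    hu.2.2 ψ hψ i, hw.2.2 ψ hψ i]
  ring

theorem HasWeakGradient.mul_smooth {w χ : Eucl N → ℝ} {g : Eucl N → Eucl N}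
    (hw : HasWeakGradient w g) (hχ : ContDiff ℝ ∞ χ) :
    HasWeakGradient (fun x => χ x * w x) (fun x => χ x • g x + w x • gradient χ x) := by
  have hχg : LocallyIntegrable (fun x => χ x • g x) volume := by
    rw [← locallyIntegrableOn_univ] at *
    exact (locallyIntegrableOn_univ.2 hw.2.1).continuousOn_smul isOpen_univ.isLocallyClosed
      hχ.continuous.continuousOn
  have hwχ : LocallyIntegrable (fun x => w x • gradient χ x) volume := by
    rw [← locallyIntegrableOn_univ] at *
    exact (locallyIntegrableOn_univ.2 hw.1).smul_continuousOn isOpen_univ.isLocallyClosed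
      (continuous_gradient hχ).continuousOn
  have hχw : LocallyIntegrable (fun x => χ x * w x) volume := by
    rw [← locallyIntegrableOn_univ] at *
    exact (locallyIntegrableOn_univ.2 hw.1).continuousOn_smul isOpen_univ.isLocallyClosed
      hχ.continuous.continuousOn
  refine ⟨hχw, hχg.add hwχ, fun ψ hψ i => ?_⟩
  set e : Eucl N := EuclideanSpace.single i 1 with he
  have hT := hψ.mul_left hχ
  have h := hw.2.2 _ hT i
  have hd : ∀ x, fderiv ℝ (fun x => χ x * ψ x) x e =
      χ x * fderiv ℝ ψ x e + fderiv ℝ χ x e * ψ x := by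
    intro x
    rw [fderiv_fun_mul (hχ.differentiable (by simp) x) (hψ.1.differentiable (by simp) x)]
    simp [mul_comm]
  have cχ : Continuous fun x => fderiv ℝ χ x e :=
    (hχ.continuous_fderiv (by simp)).clm_apply continuous_const
  have j1 : Integrable (fun x => w x * (χ x * fderiv ℝ ψ x e)) volume :=
    hw.1.integrable_mul_of_compact (hχ.continuous.mul (hψ.continuous_fderiv_apply e))
      (hψ.hasCompactSupport_fderiv_apply e).mul_left
  have j2 : Integrable (fun x => w x * (fderiv ℝ χ x e * ψ x)) volume :=
    hw.1.integrable_mul_of_compact (cχ.mul hψ.continuous) hψ.2.mul_left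
  have j3 : Integrable (fun x => g x i * (χ x * ψ x)) volume :=
    (hw.2.1.coord i).integrable_mul_of_compact hT.continuous hT.2
  rw [← he] at h
  simp only [hd, mul_add] at h
  rw [integral_add j1 j2] at h
  have l1 : ∫ x, χ x * w x * fderiv ℝ ψ x e = ∫ x, w x * (χ x * fderiv ℝ ψ x e) :=
    integral_congr_ae (Eventually.of_forall fun x => by ring)
  have l2 : ∫ x, (χ x • g x + w x • gradient χ x) i * ψ x =
      ∫ x, (g x i * (χ x * ψ x) + w x * (fderiv ℝ χ x e * ψ x)) :=
    integral_congr_ae (Eventually.of_forall fun x => by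
      simp only [PiLp.add_apply, PiLp.smul_apply, smul_eq_mul, gradient_coord, ← he]
      ring)
  rw [l1, l2, integral_add j3 j2]
  linarith

theorem mollify_coord (n : ℕ) {g : Eucl N → Eucl N} (hg : LocallyIntegrable g volume)
    (x : Eucl N) (i : Fin N) :
    mollify n g x i = ∫ y, g y i * (bump N n).normed volume (x - y) := by
  have hT := (isTest_bump (N := N) n).comp_sub_left x
  have h0 : mollify n g x = ∫ y, (bump N n).normed volume (x - y) • g y := by
    rw [mollify_apply, ← integral_sub_left_eq_self _ volume x]
    simp
  have hint : Integrable (fun y => (bump N n).normed volume (x - y) • g y) volume :=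
    hg.integrable_smul_left_of_hasCompactSupport hT.continuous hT.2
  rw [h0]
  refine ((EuclideanSpace.proj i : Eucl N →L[ℝ] ℝ).integral_comp_comm hint).symm.trans ?_
  exact integral_congr_ae (Eventually.of_forall fun y => by simp [mul_comm])

/-- The derivative falls on the kernel, and `y ↦ ρ (x - y)` is a test function. The sign from the
reflection cancels the one in the definition of the weak gradient. -/
theorem HasWeakGradient.fderiv_mollify {u : Eucl N → ℝ} {g : Eucl N → Eucl N}
    (h : HasWeakGradient u g) (n : ℕ) (x : Eucl N) (i : Fin N) :
    fderiv ℝ (mollify n u) x (EuclideanSpace.single i 1) = mollify n g x i := by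
  set ρ := (bump N n).normed (volume : Measure (Eucl N)) with hρ
  have hT : IsTest ρ := isTest_bump n
  set e : Eucl N := EuclideanSpace.single i 1 with he
  have hd := (hT.2.hasFDerivAt_convolution_left (ContinuousLinearMap.lsmul ℝ ℝ)
    (hT.1.of_le (by exact_mod_cast le_top)) h.1 x).fderiv
  have hcf : Continuous (fderiv ℝ ρ) := hT.1.continuous_fderiv (by simp)
  have hex : ConvolutionExistsAt (fderiv ℝ ρ) u x
      ((ContinuousLinearMap.lsmul ℝ ℝ).precompL (Eucl N)) volume :=
    (hT.2.fderiv ℝ).convolutionExists_left _ hcf h.1 x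
  have h1 : fderiv ℝ (mollify n u) x e = ∫ t, fderiv ℝ ρ t e * u (x - t) := by
    change fderiv ℝ (ρ ⋆[ContinuousLinearMap.lsmul ℝ ℝ, volume] u) x e = _
    rw [hd, convolution_def, ContinuousLinearMap.integral_apply hex]
    rfl
  have h2 := h.2.2 _ (hT.comp_sub_left x) i
  have h3 : ∀ y, fderiv ℝ (fun y => ρ (x - y)) y e = - fderiv ℝ ρ (x - y) e := by
    intro y
    have a : HasFDerivAt (fun y : Eucl N => x - y) (-ContinuousLinearMap.id ℝ (Eucl N)) y :=
      (hasFDerivAt_id y).const_sub x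
    have b := ((hT.1.differentiable (by simp) (x - y)).hasFDerivAt.comp y a).fderiv
    have b' : fderiv ℝ (fun y => ρ (x - y)) y = _ := b
    rw [b']
    simp
  rw [mollify_coord n h.2.1, h1, ← integral_sub_left_eq_self _ volume x]
  rw [← he] at h2
  simp only [h3, mul_neg, integral_neg, neg_inj] at h2
  rw [← h2]
  exact integral_congr_ae (Eventually.of_forall fun y => by simp [mul_comm])

theorem HasWeakGradient.gradient_mollify {u : Eucl N → ℝ} {g : Eucl N → Eucl N}
    (h : HasWeakGradient u g) (n : ℕ) : gradient (mollify n u) = mollify n g := by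
  ext x i
  rw [gradient_coord, h.fderiv_mollify]

theorem HasWeakGradient.mollify {u : Eucl N → ℝ} {g : Eucl N → Eucl N}
    (h : HasWeakGradient u g) (n : ℕ) :
    HasWeakGradient (mollify n u) (mollify n g) := by
  rw [← h.gradient_mollify n]
  exact hasWeakGradient_gradient (mollify_contDiff n h.1)

theorem lintegral_mul_tendsto_zero {α H : Type*} [MeasurableSpace α] {μ : Measure α}
    [NormedAddCommGroup H] {w : α → ℝ≥0∞} {b : ℕ → α → H} (hw : AEMeasurable w μ)
    (hwfin : ∫⁻ x, w x ^ 2 ∂μ ≠ ⊤) (hb : ∀ n, AEStronglyMeasurable (b n) μ)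
    (h : Tendsto (fun n => ∫⁻ x, ‖b n x‖ₑ ^ 2 ∂μ) atTop (𝓝 0)) :
    Tendsto (fun n => ∫⁻ x, w x * ‖b n x‖ₑ ∂μ) atTop (𝓝 0) := by
  have hle : ∀ n, ∫⁻ x, w x * ‖b n x‖ₑ ∂μ ≤
      (∫⁻ x, w x ^ 2 ∂μ) ^ (1 / 2 : ℝ) * (∫⁻ x, ‖b n x‖ₑ ^ 2 ∂μ) ^ (1 / 2 : ℝ) := by
    intro n
    have := ENNReal.lintegral_mul_le_Lp_mul_Lq μ Real.HolderConjugate.two_two hw (hb n).enorm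
    simpa using this
  have hlim : Tendsto (fun n => (∫⁻ x, w x ^ 2 ∂μ) ^ (1 / 2 : ℝ) *
      (∫⁻ x, ‖b n x‖ₑ ^ 2 ∂μ) ^ (1 / 2 : ℝ)) atTop (𝓝 0) := by
    have h1 := (ENNReal.continuous_rpow_const (y := (1 / 2 : ℝ))).continuousAt.tendsto.comp h
    rw [ENNReal.zero_rpow_of_pos (by norm_num)] at h1
    have h2 := ENNReal.Tendsto.const_mul (a := (∫⁻ x, w x ^ 2 ∂μ) ^ (1 / 2 : ℝ)) h1
      (Or.inr (ENNReal.rpow_ne_top_of_nonneg (by norm_num) hwfin))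
    simpa using h2
  exact tendsto_of_tendsto_of_tendsto_of_le_of_le tendsto_const_nhds hlim (fun _ => zero_le) hle

/-- The classical chain rule holds for the mollifications of `u`. The bounds on `η` and `η'` and the
`L²` convergence of the mollified gradients let it pass to the limit. -/
theorem HasWeakGradient.comp {u : Eucl N → ℝ} {g : Eucl N → Eucl N} (h : HasWeakGradient u g)
    (hg : MemLp g 2 volume) {η η' : ℝ → ℝ} {B C : ℝ} (hη : ContDiff ℝ ∞ η)
    (hd : ∀ t, HasDerivAt η (η' t) t) (hB : ∀ t, |η t| ≤ B) (hC : ∀ t, |η' t| ≤ C) :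
    HasWeakGradient (fun x => η (u x)) (fun x => η' (u x) • g x) := by
  have hη'c : Continuous η' := by
    have : η' = deriv η := funext fun t => (hd t).deriv.symm
    rw [this]
    exact hη.continuous_deriv (by simp)
  have hum : AEStronglyMeasurable u volume := h.1.aestronglyMeasurable
  have hηu : AEStronglyMeasurable (fun x => η (u x)) volume :=
    hη.continuous.comp_aestronglyMeasurable hum
  have hη'u : AEStronglyMeasurable (fun x => η' (u x)) volume :=
    hη'c.comp_aestronglyMeasurable hum
  have hG : MemLp (fun x => η' (u x) • g x) 2 volume :=
    hg.of_le_mul (c := C) (hη'u.smul hg.1) (Eventually.of_forall fun x => by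
      rw [norm_smul]
      exact mul_le_mul_of_nonneg_right (hC _) (norm_nonneg _))
  refine ⟨?_, hG.locallyIntegrable_two, fun ψ hψ i => ?_⟩
  · refine (locallyIntegrable_const B).mono hηu (Eventually.of_forall fun x => ?_)
    exact (hB _).trans (le_abs_self B)
  set e : Eucl N := EuclideanSpace.single i 1 with he
  set un : ℕ → Eucl N → ℝ := fun n => Choquard.mollify n u with hun
  have hsm : ∀ n, ContDiff ℝ ∞ (un n) := fun n => mollify_contDiff n h.1
  have hmg : ∀ n, AEStronglyMeasurable (Choquard.mollify n g) volume := fun n =>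
    (mollify_contDiff n h.2.1).continuous.aestronglyMeasurable
  have hconv := mollify_tendsto_ae h.1
  have hparts : ∀ n, ∫ x, η (un n x) * fderiv ℝ ψ x e =
      - ∫ x, (η' (un n x) * Choquard.mollify n g x i) * ψ x := by
    intro n
    rw [integral_mul_fderiv_test (w := fun x => η (un n x))
      ((hη.comp (hsm n)).of_le (by exact_mod_cast le_top)) hψ e]
    congr 1
    refine integral_congr_ae (Eventually.of_forall fun x => ?_)
    have a := ((hd (un n x)).comp_hasFDerivAt x
      ((hsm n).differentiable (by simp) x).hasFDerivAt).fderiv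
    have a' : fderiv ℝ (fun x => η (un n x)) x = _ := a
    simp only [a']
    rw [smul_apply, smul_eq_mul, he, h.fderiv_mollify]
  have hL : Tendsto (fun n => ∫ x, η (un n x) * fderiv ℝ ψ x e) atTop
      (𝓝 (∫ x, η (u x) * fderiv ℝ ψ x e)) := by
    refine tendsto_integral_of_dominated_convergence (fun x => B * ‖fderiv ℝ ψ x e‖)
      (fun n => ?_) ?_ (fun n => Eventually.of_forall fun x => ?_) ?_
    · exact ((hη.continuous.comp (hsm n).continuous).mul
        (hψ.continuous_fderiv_apply e)).aestronglyMeasurable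
    · exact ((hψ.continuous_fderiv_apply e).integrable_of_hasCompactSupport
        (hψ.hasCompactSupport_fderiv_apply e)).norm.const_mul B
    · rw [norm_mul]
      exact mul_le_mul_of_nonneg_right (hB _) (norm_nonneg _)
    · filter_upwards [hconv] with x hx
      exact ((hη.continuous.tendsto _).comp hx).mul_const _
  have hψ2 : ∫⁻ x, ‖ψ x‖ₑ ^ 2 ≠ ⊤ :=
    (hψ.continuous.memLp_of_hasCompactSupport hψ.2).lintegral_enorm_sq_lt_top.ne
  have hgi := h.2.1.coord i
  have hint1 : Integrable (fun x => g x i * ψ x) volume :=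
    hgi.integrable_mul_of_compact hψ.continuous hψ.2
  -- The gradient term is split in two: with `g` fixed, `η' (uₙ)` converges by domination; the error
  -- `mollify n g - g` is small in `L²` and is tested against a function bounded by `C |ψ|`.
  have hR1 : Tendsto (fun n => ∫ x, η' (un n x) * (g x i * ψ x)) atTop
      (𝓝 (∫ x, η' (u x) * (g x i * ψ x))) := by
    refine tendsto_integral_of_dominated_convergence (fun x => C * ‖g x i * ψ x‖)
      (fun n => ?_) (hint1.norm.const_mul C) (fun n => Eventually.of_forall fun x => ?_) ?_
    · exact (hη'c.comp (hsm n).continuous).aestronglyMeasurable.mul hint1.1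
    · rw [norm_mul]
      exact mul_le_mul_of_nonneg_right (hC _) (norm_nonneg _)
    · filter_upwards [hconv] with x hx
      exact ((hη'c.tendsto _).comp hx).mul_const _
  have hR2 : Tendsto (fun n => ∫ x, (η' (un n x) * ψ x) * (Choquard.mollify n g x i - g x i))
      atTop (𝓝 0) := by
    have hz := lintegral_mul_tendsto_zero (w := fun x => ENNReal.ofReal C * ‖ψ x‖ₑ)
      (b := fun n x => Choquard.mollify n g x - g x)
      (hψ.continuous.aestronglyMeasurable.enorm.const_mul _) (by
        simp only [mul_pow]
        rw [lintegral_const_mul' _ _ (ENNReal.pow_ne_top ENNReal.ofReal_ne_top)]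
        exact ENNReal.mul_ne_top (ENNReal.pow_ne_top ENNReal.ofReal_ne_top) hψ2)
      (fun n => (hmg n).sub hg.1) (mollify_tendsto_L2 hg)
    rw [tendsto_zero_iff_enorm_tendsto_zero]
    refine tendsto_of_tendsto_of_tendsto_of_le_of_le tendsto_const_nhds hz (fun _ => zero_le)
      fun n => (enorm_integral_le_lintegral_enorm _).trans (lintegral_mono fun x => ?_)
    rw [enorm_mul, enorm_mul]
    gcongr
    · rw [Real.enorm_eq_ofReal_abs]
      exact ENNReal.ofReal_le_ofReal (hC _)
    · have := PiLp.norm_apply_le (Choquard.mollify n g x - g x) i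
      simpa [← ofReal_norm] using ENNReal.ofReal_le_ofReal this
  have hmgi : ∀ n, Continuous fun x => Choquard.mollify n g x i := fun n =>
    (EuclideanSpace.proj i : Eucl N →L[ℝ] ℝ).continuous.comp (mollify_contDiff n h.2.1).continuous
  have hR : Tendsto (fun n => ∫ x, (η' (un n x) * Choquard.mollify n g x i) * ψ x) atTop
      (𝓝 (∫ x, η' (u x) * (g x i * ψ x))) := by
    have := hR1.add hR2
    rw [add_zero] at this
    refine this.congr fun n => ?_
    have cη := hη'c.comp (hsm n).continuous
    have k1 : Integrable (fun x => η' (un n x) * (g x i * ψ x)) volume := by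
      refine hint1.bdd_mul (c := C) cη.aestronglyMeasurable (Eventually.of_forall fun x => hC _)
    have k2 : Integrable (fun x => (η' (un n x) * Choquard.mollify n g x i) * ψ x) volume :=
      ((cη.mul (hmgi n)).mul hψ.continuous).integrable_of_hasCompactSupport hψ.2.mul_left
    have k3 : Integrable
        (fun x => (η' (un n x) * ψ x) * (Choquard.mollify n g x i - g x i)) volume := by
      refine (k2.sub k1).congr (Eventually.of_forall fun x => ?_)
      simp only [Pi.sub_apply]
      ring
    rw [← integral_add k1 k3]
    exact integral_congr_ae (Eventually.of_forall fun x => by ring)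
  have hfin := tendsto_nhds_unique (hL.congr hparts) hR.neg
  rw [hfin]
  congr 1
  exact integral_congr_ae (Eventually.of_forall fun x => by
    simp only [PiLp.smul_apply, smul_eq_mul]; ring)

theorem h1Norm_tendsto_zero {w : ℕ → Eucl N → ℝ} {G : ℕ → Eucl N → Eucl N}
    (h : ∀ n, HasWeakGradient (w n) (G n))
    (hw : Tendsto (fun n => ∫⁻ x, ‖w n x‖ₑ ^ 2) atTop (𝓝 0))
    (hG : Tendsto (fun n => ∫⁻ x, ‖G n x‖ₑ ^ 2) atTop (𝓝 0)) :
    Tendsto (fun n => h1Norm (w n)) atTop (𝓝 0) := by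
  have key : ∀ n, h1Norm (w n) =
      Real.sqrt ((∫⁻ x, ‖G n x‖ₑ ^ 2) + ∫⁻ x, ‖w n x‖ₑ ^ 2).toReal := by
    intro n
    have mG := (h n).2.1.aestronglyMeasurable
    have mw := (h n).1.aestronglyMeasurable
    have e1 : ∫ x, (‖weakGrad (w n) x‖ ^ 2 + |w n x| ^ 2) = ∫ x, (‖G n x‖ ^ 2 + |w n x| ^ 2) := by
      refine integral_congr_ae ?_
      filter_upwards [(h n).weakGrad_ae_eq] with x hx
      rw [hx]
    have m : AEStronglyMeasurable (fun x => ‖G n x‖ ^ 2 + |w n x| ^ 2) volume :=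
      (mG.norm.pow 2).add (mw.norm.pow 2)
    rw [h1Norm, e1, integral_eq_lintegral_of_nonneg_ae
      (Eventually.of_forall fun x => by positivity) m, ← lintegral_add_left' (mG.enorm.pow_const 2)]
    congr 2
    refine lintegral_congr fun x => ?_
    rw [ENNReal.ofReal_add (by positivity) (by positivity), ENNReal.ofReal_pow (norm_nonneg _),
      ENNReal.ofReal_pow (abs_nonneg _), ofReal_norm, Real.enorm_eq_ofReal_abs]
  have hs := hG.add hw
  rw [add_zero] at hs
  have ht := (ENNReal.tendsto_toReal ENNReal.zero_ne_top).comp hs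
  have hr := (Real.continuous_sqrt.tendsto _).comp ht
  simp only [ENNReal.toReal_zero, Real.sqrt_zero] at hr
  exact hr.congr fun n => (key n).symm

theorem h1Norm_mollify_sub_tendsto_zero {w : Eucl N → ℝ} {G : Eucl N → Eucl N}
    (h : HasWeakGradient w G) (hw : MemLp w 2 volume) (hG : MemLp G 2 volume) :
    Tendsto (fun n => h1Norm (fun x => mollify n w x - w x)) atTop (𝓝 0) :=
  h1Norm_tendsto_zero (fun n => (h.mollify n).sub h) (mollify_tendsto_L2 hw) (mollify_tendsto_L2 hG)

theorem memH1_of_hasWeakGradient {w : Eucl N → ℝ} {G : Eucl N → Eucl N}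
    (h : HasWeakGradient w G) (hw : MemLp w 2 volume) (hG : MemLp G 2 volume) : MemH1 w :=
  ⟨hw, ⟨G, h⟩, hG.ae_eq h.weakGrad_ae_eq.symm⟩

end WeakGradient

/-! ### The Sobolev inequality for test functions, by dimension. -/

section Sobolev

theorem rpow_le_rpow_add_rpow (a : ℝ≥0∞) {l s r : ℝ} (hls : l ≤ s) (hsr : s ≤ r) :
    a ^ s ≤ a ^ l + a ^ r := by
  rcases le_total a 1 with h | h
  · exact (ENNReal.rpow_le_rpow_of_exponent_ge h hls).trans le_self_add
  · exact (ENNReal.rpow_le_rpow_of_exponent_le h hsr).trans le_add_self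

theorem lintegral_rpow_le_of_supercritical {N : ℕ} (hN : 3 ≤ N) {s : ℝ} (hs : 2 ≤ s)
    (hsN : 1 / 2 - 1 / (N : ℝ) ≤ 1 / s) {A : ℝ≥0∞} (hA : A ≠ ⊤) :
    ∃ B : ℝ≥0∞, B ≠ ⊤ ∧ ∀ v : Eucl N → ℝ, IsTest v → ∫⁻ x, ‖v x‖ₑ ^ 2 ≤ A →
      ∫⁻ x, ‖fderiv ℝ v x‖ₑ ^ 2 ≤ A → ∫⁻ x, ‖v x‖ₑ ^ s ≤ B := by
  have hN' : (3 : ℝ) ≤ N := by exact_mod_cast hN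
  have hpos : 0 < 1 / 2 - 1 / (N : ℝ) := by
    have : 1 / (N : ℝ) ≤ 1 / 3 := one_div_le_one_div_of_le (by norm_num) hN'
    linarith
  -- The critical exponent `2N/(N-2)`. The exponent `s` lies between `2` and `r`, so it is reached
  -- by adding the two endpoint bounds.
  set r : NNReal := ⟨(1 / 2 - 1 / (N : ℝ))⁻¹, by positivity⟩ with hr
  have hrv : (r : ℝ) = (1 / 2 - 1 / (N : ℝ))⁻¹ := rfl
  have hsr : s ≤ r := by
    rw [hrv, ← one_div, le_one_div (by linarith) hpos]
    exact hsN
  have hr0 : r ≠ 0 := by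
    intro h
    rw [h] at hsr
    norm_num at hsr
    linarith
  obtain ⟨C, hgns⟩ : ∃ C : NNReal, ∀ v : Eucl N → ℝ, IsTest v →
      eLpNorm v r volume ≤ C * eLpNorm (fderiv ℝ v) (2 : NNReal) volume :=
    ⟨_, fun v hv => eLpNorm_le_eLpNorm_fderiv_of_eq_inner (volume : Measure (Eucl N))
      (hv.1.of_le (by exact_mod_cast le_top)) hv.2 (p := 2) (p' := r) (by norm_num)
      (by rw [finrank_euclideanSpace_fin]; omega)
      (by rw [finrank_euclideanSpace_fin, hrv, inv_inv]; norm_num)⟩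
  refine ⟨A + (C * A ^ (1 / 2 : ℝ)) ^ (r : ℝ), ?_, fun v hv hv2 hdv => ?_⟩
  · exact ENNReal.add_ne_top.2 ⟨hA, ENNReal.rpow_ne_top_of_nonneg r.2
      (ENNReal.mul_ne_top ENNReal.coe_ne_top (ENNReal.rpow_ne_top_of_nonneg (by norm_num) hA))⟩
  · have h2 : eLpNorm (fderiv ℝ v) (2 : NNReal) volume ≤ A ^ (1 / 2 : ℝ) := by
      rw [eLpNorm_nnreal_eq_lintegral two_ne_zero]
      have : ∫⁻ x, ‖fderiv ℝ v x‖ₑ ^ ((2 : NNReal) : ℝ) ≤ A := by simpa using hdv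
      exact ENNReal.rpow_le_rpow this (by norm_num)
    have h3 : ∫⁻ x, ‖v x‖ₑ ^ (r : ℝ) ≤ (C * A ^ (1 / 2 : ℝ)) ^ (r : ℝ) := by
      rw [← eLpNorm_nnreal_pow_eq_lintegral hr0]
      exact ENNReal.rpow_le_rpow ((hgns v hv).trans (by gcongr)) r.2
    calc ∫⁻ x, ‖v x‖ₑ ^ s ≤ ∫⁻ x, (‖v x‖ₑ ^ (2 : ℝ) + ‖v x‖ₑ ^ (r : ℝ)) :=
          lintegral_mono fun x => rpow_le_rpow_add_rpow _ hs hsr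
      _ = (∫⁻ x, ‖v x‖ₑ ^ (2 : ℝ)) + ∫⁻ x, ‖v x‖ₑ ^ (r : ℝ) :=
          lintegral_add_left (hv.continuous.enorm.measurable.pow_const _) _
      _ ≤ _ := by
          refine add_le_add ?_ h3
          simpa using hv2

/-- In the plane `H¹` lies in every `L^s` with `2 ≤ s < ∞`. The even exponents follow by induction
from `‖f‖₂ ≤ C ‖∇f‖₁` with `f = v^(m+2)`, because `|∇f| = (m+2)|v|^(m+1)|∇v|` is at most
`(m+2)(|v|^(2(m+1)) + |∇v|²)`. -/
theorem lintegral_pow_two_mul_le (m : ℕ) {A : ℝ≥0∞} (hA : A ≠ ⊤) :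
    ∃ B : ℝ≥0∞, B ≠ ⊤ ∧ ∀ v : Eucl 2 → ℝ, IsTest v → ∫⁻ x, ‖v x‖ₑ ^ 2 ≤ A →
      ∫⁻ x, ‖fderiv ℝ v x‖ₑ ^ 2 ≤ A → ∫⁻ x, ‖v x‖ₑ ^ (2 * (m + 1)) ≤ B := by
  induction m with
  | zero => exact ⟨A, hA, fun v _ hv _ => by simpa using hv⟩
  | succ m ih =>
    obtain ⟨B, hB, hvB⟩ := ih
    obtain ⟨C, hgns⟩ : ∃ C : NNReal, ∀ f : Eucl 2 → ℝ, ContDiff ℝ 1 f → HasCompactSupport f →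
        ∫⁻ x, ‖f x‖ₑ ^ (2 : ℝ) ≤ C * (∫⁻ x, ‖fderiv ℝ f x‖ₑ) ^ (2 : ℝ) :=
      ⟨_, fun f hf hc => lintegral_pow_le_pow_lintegral_fderiv (volume : Measure (Eucl 2)) hf hc
        (by rw [finrank_euclideanSpace_fin]; exact_mod_cast Real.HolderConjugate.two_two)⟩
    refine ⟨C * (((m + 2 : ℕ) : ℝ≥0∞) * (B + A)) ^ (2 : ℝ), ?_, fun v hv hv2 hdv => ?_⟩
    · have hD : ((m + 2 : ℕ) : ℝ≥0∞) * (B + A) ≠ ⊤ :=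
        ENNReal.mul_ne_top (ENNReal.natCast_ne_top _) (ENNReal.add_ne_top.2 ⟨hB, hA⟩)
      refine ENNReal.mul_ne_top ENNReal.coe_ne_top ?_
      exact ENNReal.rpow_ne_top_of_nonneg zero_le_two hD
    have hc : HasCompactSupport fun x => v x ^ (m + 2) :=
      hv.2.comp_left (g := fun a : ℝ => a ^ (m + 2)) (zero_pow (by omega))
    have hd : ∀ x, ‖fderiv ℝ (fun x => v x ^ (m + 2)) x‖ₑ ≤
        ((m + 2 : ℕ) : ℝ≥0∞) * (‖v x‖ₑ ^ (2 * (m + 1)) + ‖fderiv ℝ v x‖ₑ ^ 2) := by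
      intro x
      rw [((hv.1.differentiable (by simp) x).hasFDerivAt.pow (m + 2)).fderiv, enorm_smul]
      have e1 : ‖(m + 2 : ℕ) • v x ^ (m + 2 - 1)‖ₑ = ((m + 2 : ℕ) : ℝ≥0∞) * ‖v x‖ₑ ^ (m + 1) := by
        rw [nsmul_eq_mul, enorm_mul, enorm_pow, Nat.add_sub_assoc (by norm_num)]
        congr 1
        rw [← ofReal_norm, Real.norm_natCast, ENNReal.ofReal_natCast]
      rw [e1, mul_assoc]
      gcongr
      rw [mul_comm 2, pow_mul]
      rcases le_total (‖v x‖ₑ ^ (m + 1)) (‖fderiv ℝ v x‖ₑ) with h | h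
      · refine le_trans ?_ le_add_self
        rw [sq]
        gcongr
      · refine le_trans ?_ le_self_add
        rw [sq]
        gcongr
    have hI : ∫⁻ x, ‖fderiv ℝ (fun x => v x ^ (m + 2)) x‖ₑ ≤
        ((m + 2 : ℕ) : ℝ≥0∞) * (B + A) := by
      refine (lintegral_mono hd).trans ?_
      rw [lintegral_const_mul' _ _ (ENNReal.natCast_ne_top _),
        lintegral_add_left (hv.continuous.enorm.measurable.pow_const _)]
      gcongr
      exact hvB v hv hv2 hdv
    calc ∫⁻ x, ‖v x‖ₑ ^ (2 * (m + 1 + 1)) = ∫⁻ x, ‖v x ^ (m + 2)‖ₑ ^ (2 : ℝ) := by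
          refine lintegral_congr fun x => ?_
          rw [enorm_pow, ENNReal.rpow_ofNat, ← pow_mul]
          ring_nf
      _ ≤ _ := (hgns _ ((hv.1.of_le (by exact_mod_cast le_top)).pow (m + 2)) hc).trans (by gcongr)

theorem lintegral_line_eq (H : Eucl 1 → ℝ≥0∞) (x : Eucl 1) :
    ∫⁻ t : ℝ, H (x + t • EuclideanSpace.single 0 1) = ∫⁻ y, H y := by
  rw [← lintegral_add_left_eq_self H x]
  have h1 := (volume_preserving_funUnique (Fin 1) ℝ).symm
  have h2 := PiLp.volume_preserving_toLp (Fin 1)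
  have e2 : MeasurableEmbedding (WithLp.toLp 2 : (Fin 1 → ℝ) → Eucl 1) :=
    (MeasurableEquiv.toLp 2 (Fin 1 → ℝ)).measurableEmbedding
  rw [← h2.lintegral_comp_emb e2]
  refine Eq.trans ?_ (h1.lintegral_comp_emb (MeasurableEquiv.measurableEmbedding _) _)
  refine lintegral_congr fun t => ?_
  congr 2
  ext i
  fin_cases i
  simp [MeasurableEquiv.funUnique]

/-- On the line, `v²` at a point is at most the integral of `|(v²)'| = 2|v v'|` over a half-line. -/
theorem enorm_sq_le_of_line {v : Eucl 1 → ℝ} (hv : IsTest v) (x : Eucl 1) :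
    ‖v x‖ₑ ^ 2 ≤ 2 * (∫⁻ y, ‖v y‖ₑ ^ 2 + ‖fderiv ℝ v y‖ₑ ^ 2) := by
  set e : Eucl 1 := EuclideanSpace.single 0 1 with he
  have hne : ‖e‖ = 1 := by simp [he]
  have hline : ContDiff ℝ 1 fun t : ℝ => x + t • e := by fun_prop
  have hf : ContDiff ℝ 1 fun t : ℝ => v (x + t • e) ^ 2 :=
    ((hv.1.of_le (by exact_mod_cast le_top)).comp hline).pow 2
  have hcl : Topology.IsClosedEmbedding fun t : ℝ => x + t • e := by
    refine (Homeomorph.addLeft x).isClosedEmbedding.comp ?_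
    exact isClosedEmbedding_smul_left (by intro h; simp [h] at hne)
  have hcs : HasCompactSupport fun t : ℝ => v (x + t • e) ^ 2 :=
    (hv.2.comp_isClosedEmbedding hcl).comp_left (g := fun a : ℝ => a ^ 2) (by simp)
  have h := hcs.enorm_le_lintegral_Ici_deriv hf 0
  simp only [zero_smul, add_zero, enorm_pow] at h
  rw [← lintegral_line_eq _ x, ← lintegral_const_mul' _ _ (by norm_num)]
  refine h.trans ((setLIntegral_le_lintegral _ _).trans (lintegral_mono fun t => ?_))
  have hd : HasDerivAt (fun t : ℝ => v (x + t • e) ^ 2)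
      (2 * v (x + t • e) * fderiv ℝ v (x + t • e) e) t := by
    have h1 : HasDerivAt (fun t : ℝ => x + t • e) e t := by
      simpa using ((hasDerivAt_id t).smul_const e).const_add x
    have h2 := ((hv.1.differentiable (by simp) (x + t • e)).hasFDerivAt.comp_hasDerivAt t h1).pow 2
    simpa [Function.comp_def, Pi.pow_def] using h2
  rw [hd.deriv, enorm_mul, enorm_mul, mul_assoc]
  have h2 : ‖(2 : ℝ)‖ₑ = 2 := by simp [← ofReal_norm]
  rw [h2]
  gcongr
  have hle : ‖fderiv ℝ v (x + t • e) e‖ₑ ≤ ‖fderiv ℝ v (x + t • e)‖ₑ := by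
    rw [← ofReal_norm, ← ofReal_norm]
    exact ENNReal.ofReal_le_ofReal ((ContinuousLinearMap.le_opNorm _ _).trans (by rw [hne, mul_one]))
  rw [← he]
  rcases le_total (‖v (x + t • e)‖ₑ) (‖fderiv ℝ v (x + t • e)‖ₑ) with h | h
  · refine le_trans ?_ le_add_self
    rw [sq]
    gcongr
  · refine le_trans ?_ le_self_add
    rw [sq]
    gcongr
    exact hle.trans h

/-- The Sobolev embedding `H¹ ⊂ Lˢ` on test functions. -/
theorem exists_lintegral_rpow_le {N : ℕ} (hN : 1 ≤ N) {s : ℝ} (hs : 2 ≤ s)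
    (hsN : 1 / 2 - 1 / (N : ℝ) ≤ 1 / s) {A : ℝ≥0∞} (hA : A ≠ ⊤) :
    ∃ B : ℝ≥0∞, B ≠ ⊤ ∧ ∀ v : Eucl N → ℝ, IsTest v → ∫⁻ x, ‖v x‖ₑ ^ 2 ≤ A →
      ∫⁻ x, ‖fderiv ℝ v x‖ₑ ^ 2 ≤ A → ∫⁻ x, ‖v x‖ₑ ^ s ≤ B := by
  rcases (by omega : N = 1 ∨ N = 2 ∨ 3 ≤ N) with rfl | rfl | h3
  · refine ⟨A * (2 * (A + A)) ^ ((s - 2) / 2), ?_, fun v hv hv2 hdv => ?_⟩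
    · exact ENNReal.mul_ne_top hA (ENNReal.rpow_ne_top_of_nonneg (by linarith)
        (ENNReal.mul_ne_top (by norm_num) (ENNReal.add_ne_top.2 ⟨hA, hA⟩)))
    have hsup : ∀ x, ‖v x‖ₑ ^ 2 ≤ 2 * (A + A) := fun x => by
      refine (enorm_sq_le_of_line hv x).trans ?_
      rw [lintegral_add_left (hv.continuous.enorm.measurable.pow_const _)]
      gcongr
    -- In dimension one `v` is bounded, so `|v|^s = |v|² (|v|²)^((s-2)/2)` costs only a constant
    -- factor.
    have hpt : ∀ x, ‖v x‖ₑ ^ s ≤ ‖v x‖ₑ ^ 2 * (2 * (A + A)) ^ ((s - 2) / 2) := fun x => by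
      have e : ‖v x‖ₑ ^ s = ‖v x‖ₑ ^ 2 * (‖v x‖ₑ ^ 2) ^ ((s - 2) / 2) := by
        rw [← ENNReal.rpow_natCast, ← ENNReal.rpow_mul,
          ← ENNReal.rpow_add_of_nonneg _ _ (by norm_num) (by push_cast; linarith)]
        congr 1
        push_cast
        ring
      rw [e]
      gcongr
      exact hsup x
    refine (lintegral_mono hpt).trans ?_
    rw [lintegral_mul_const _ (hv.continuous.enorm.measurable.pow_const _)]
    gcongr
  · obtain ⟨m, hm⟩ := exists_nat_ge s
    obtain ⟨B, hB, hvB⟩ := lintegral_pow_two_mul_le m hA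
    refine ⟨A + B, ENNReal.add_ne_top.2 ⟨hA, hB⟩, fun v hv hv2 hdv => ?_⟩
    have hm' : s ≤ ((2 * (m + 1) : ℕ) : ℝ) := by
      push_cast
      have : (0 : ℝ) ≤ m := by positivity
      linarith
    calc ∫⁻ x, ‖v x‖ₑ ^ s ≤ ∫⁻ x, (‖v x‖ₑ ^ (2 : ℝ) + ‖v x‖ₑ ^ ((2 * (m + 1) : ℕ) : ℝ)) :=
          lintegral_mono fun x => rpow_le_rpow_add_rpow _ hs hm'
      _ = (∫⁻ x, ‖v x‖ₑ ^ (2 : ℝ)) + ∫⁻ x, ‖v x‖ₑ ^ ((2 * (m + 1) : ℕ) : ℝ) :=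
          lintegral_add_left (hv.continuous.enorm.measurable.pow_const _) _
      _ ≤ _ := by
          simp only [ENNReal.rpow_natCast, ENNReal.rpow_ofNat]
          exact add_le_add hv2 (hvB v hv hv2 hdv)
  · exact lintegral_rpow_le_of_supercritical h3 hs hsN hA

end Sobolev

/-! ### Smooth cutoffs at growing scales. -/

section Cutoff

variable {N : ℕ}

/-- The smooth cutoff equal to `1` on the ball of radius `n + 1`, and to `0` outside the ball of
radius `2 (n + 1)`. -/
def cutoff (N n : ℕ) : Eucl N → ℝ :=
  fun x => (⟨1, 2, one_pos, one_lt_two⟩ : ContDiffBump (0 : Eucl N)) ((1 / ((n : ℝ) + 1)) • x)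

theorem isTest_cutoff (n : ℕ) : IsTest (cutoff N n) :=
  ⟨(ContDiffBump.contDiff _).comp (contDiff_const_smul _),
    (ContDiffBump.hasCompactSupport _).comp_homeomorph
      (Homeomorph.smulOfNeZero (1 / ((n : ℝ) + 1)) (by positivity))⟩

theorem cutoff_nonneg (n : ℕ) (x : Eucl N) : 0 ≤ cutoff N n x := ContDiffBump.nonneg _

theorem cutoff_le_one (n : ℕ) (x : Eucl N) : cutoff N n x ≤ 1 := ContDiffBump.le_one _

theorem cutoff_tendsto (x : Eucl N) : Tendsto (fun n => cutoff N n x) atTop (𝓝 1) := by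
  obtain ⟨m, hm⟩ := exists_nat_ge ‖x‖
  refine tendsto_const_nhds.congr' ?_
  filter_upwards [eventually_ge_atTop m] with n hn
  refine (ContDiffBump.one_of_mem_closedBall _ ?_).symm
  have h1 : (0 : ℝ) < (n : ℝ) + 1 := by positivity
  have h2 : (m : ℝ) ≤ n := by exact_mod_cast hn
  rw [mem_closedBall_zero_iff, norm_smul, Real.norm_of_nonneg (by positivity), one_div,
    inv_mul_le_iff₀ h1]
  linarith

/-- All cutoffs are dilations of one bump, so their gradients scale like the inverse of the radius.
-/
theorem exists_norm_gradient_cutoff_le (N : ℕ) : ∃ C : ℝ, 0 ≤ C ∧ ∀ (n : ℕ) (x : Eucl N),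
    ‖gradient (cutoff N n) x‖ ≤ 1 / ((n : ℝ) + 1) * C := by
  set b : ContDiffBump (0 : Eucl N) := ⟨1, 2, one_pos, one_lt_two⟩ with hb
  have hbd : ContDiff ℝ 1 b := b.contDiff
  obtain ⟨C, hC⟩ := (b.hasCompactSupport.fderiv ℝ).exists_bound_of_continuous
    (hbd.continuous_fderiv one_ne_zero)
  refine ⟨C, (norm_nonneg _).trans (hC 0), fun n x => ?_⟩
  have h : cutoff N n = fun x => b ((1 / ((n : ℝ) + 1)) • x) := rfl
  rw [norm_gradient, h, fderiv_comp_smul, norm_smul, Real.norm_of_nonneg (by positivity)]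
  gcongr
  exact hC _

end Cutoff

/-! ### Sobolev's embedding for `H¹`, and Young's inequality for the convolution. -/

section Embedding

variable {N : ℕ}

/-- The Sobolev embedding `H¹ ⊂ Lˢ`. -/
theorem HasWeakGradient.lintegral_rpow_lt_top (hN : 1 ≤ N) {s : ℝ} (hs : 2 ≤ s)
    (hsN : 1 / 2 - 1 / (N : ℝ) ≤ 1 / s) {u : Eucl N → ℝ} {g : Eucl N → Eucl N}
    (h : HasWeakGradient u g) (hu : MemLp u 2 volume) (hg : MemLp g 2 volume) :
    ∫⁻ x, ‖u x‖ₑ ^ s < ⊤ := by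
  obtain ⟨C, hC0, hC⟩ := exists_norm_gradient_cutoff_le N
  have hχ1 : ∀ n x, ‖cutoff N n x‖ₑ ≤ 1 := fun n x => by
    rw [← ofReal_norm, Real.norm_of_nonneg (cutoff_nonneg n x)]
    exact ENNReal.ofReal_le_one.2 (cutoff_le_one n x)
  have hχ2 : ∀ n x, ‖gradient (cutoff N n) x‖ₑ ≤ ENNReal.ofReal C := fun n x => by
    rw [← ofReal_norm]
    refine ENNReal.ofReal_le_ofReal ((hC n x).trans (mul_le_of_le_one_left hC0 ?_))
    rw [div_le_one (by positivity)]
    have : (0 : ℝ) ≤ n := by positivity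
    linarith
  set U := ∫⁻ x, ‖u x‖ₑ ^ 2 with hU
  set G := ∫⁻ x, ‖g x‖ₑ ^ 2 with hG
  have hUt : U ≠ ⊤ := hu.lintegral_enorm_sq_lt_top.ne
  have hGt : G ≠ ⊤ := hg.lintegral_enorm_sq_lt_top.ne
  set D := ENNReal.ofReal C ^ 2 with hD
  have hDt : D ≠ ⊤ := ENNReal.pow_ne_top ENNReal.ofReal_ne_top
  -- This bounds the squared `L²` norms of the approximants and of their gradients, uniformly in
  -- `n`. The factor `4` comes from `(a + b)² ≤ 4a² + 4b²`.
  have hA : U + (4 * G + 4 * (D * U)) ≠ ⊤ := by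
    simp [ENNReal.add_eq_top, ENNReal.mul_eq_top, hUt, hGt, hDt]
  obtain ⟨B, hB, hvB⟩ := exists_lintegral_rpow_le hN hs hsN hA
  have hsm : ∀ n, ContDiff ℝ ∞ (Choquard.mollify n u) := fun n => mollify_contDiff n h.1
  -- These are test functions converging to `u` almost everywhere, so the uniform `L^s` bound passes
  -- to `u` by Fatou's lemma.
  set v : ℕ → Eucl N → ℝ := fun n x => cutoff N n x * Choquard.mollify n u x with hv
  have hvT : ∀ n, IsTest (v n) := fun n =>
    ⟨(isTest_cutoff n).1.mul (hsm n), (isTest_cutoff n).2.mul_right⟩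
  have hv2 : ∀ n, ∫⁻ x, ‖v n x‖ₑ ^ 2 ≤ U := fun n => by
    refine (lintegral_mono fun x => ?_).trans (lintegral_mollify_sq_le n hu.1)
    simp only [hv, enorm_mul]
    exact pow_le_pow_left' (mul_le_of_le_one_left' (hχ1 n x)) 2
  have hvd : ∀ n, ∫⁻ x, ‖fderiv ℝ (v n) x‖ₑ ^ 2 ≤ 4 * G + 4 * (D * U) := fun n => by
    have hae := (hasWeakGradient_gradient (hvT n).1).ae_unique
      ((h.mollify n).mul_smooth (isTest_cutoff n).1)
    have hle : ∀ᵐ x, ‖fderiv ℝ (v n) x‖ₑ ^ 2 ≤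
        4 * ‖Choquard.mollify n g x‖ₑ ^ 2 + 4 * (D * ‖Choquard.mollify n u x‖ₑ ^ 2) := by
      filter_upwards [hae] with x hx
      have e : ‖fderiv ℝ (v n) x‖ₑ = ‖gradient (v n) x‖ₑ := by
        rw [← ofReal_norm, ← ofReal_norm, norm_gradient]
      set a := ‖Choquard.mollify n g x‖ₑ
      set b := ‖Choquard.mollify n u x‖ₑ
      have e2 : ‖gradient (v n) x‖ₑ ≤ a + ENNReal.ofReal C * b := by
        rw [hx]
        refine (enorm_add_le _ _).trans (add_le_add ?_ ?_)
        · rw [enorm_smul]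
          exact mul_le_of_le_one_left' (hχ1 n x)
        · rw [enorm_smul, mul_comm]
          exact mul_le_mul_left (hχ2 n x) _
      rw [e, hD, ← mul_pow]
      refine (pow_le_pow_left' e2 2).trans ?_
      have four : (4 : ℝ≥0∞) = 2 ^ 2 := by norm_num
      rcases le_total a (ENNReal.ofReal C * b) with hab | hab
      · refine le_trans ?_ le_add_self
        rw [four, ← mul_pow, two_mul]
        gcongr
      · refine le_trans ?_ le_self_add
        rw [four, ← mul_pow, two_mul]
        gcongr
    refine (lintegral_mono_ae hle).trans ?_
    rw [lintegral_add_left (by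
        exact ((mollify_contDiff n h.2.1).continuous.enorm.measurable.pow_const 2).const_mul 4),
      lintegral_const_mul' _ _ (by norm_num), lintegral_const_mul' _ _ (by norm_num),
      lintegral_const_mul' _ _ hDt]
    gcongr
    · exact lintegral_mollify_sq_le n hg.1
    · exact lintegral_mollify_sq_le n hu.1
  have hbd : ∀ n, ∫⁻ x, ‖v n x‖ₑ ^ s ≤ B := fun n =>
    hvB (v n) (hvT n) ((hv2 n).trans le_self_add) ((hvd n).trans le_add_self)
  have hlim : ∀ᵐ x, Tendsto (fun n => ‖v n x‖ₑ ^ s) atTop (𝓝 (‖u x‖ₑ ^ s)) := by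
    filter_upwards [mollify_tendsto_ae h.1] with x hx
    have h1 := (cutoff_tendsto x).mul hx
    rw [one_mul] at h1
    exact (ENNReal.continuous_rpow_const.tendsto _).comp h1.enorm
  have hfatou : ∫⁻ x, ‖u x‖ₑ ^ s ≤ liminf (fun n => ∫⁻ x, ‖v n x‖ₑ ^ s) atTop := by
    refine le_trans (le_of_eq ?_) (lintegral_liminf_le fun n =>
      (hvT n).continuous.enorm.measurable.pow_const s)
    refine lintegral_congr_ae ?_
    filter_upwards [hlim] with x hx
    exact hx.liminf_eq.symm
  refine (hfatou.trans ?_).trans_lt hB.lt_top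
  exact (liminf_le_liminf (Eventually.of_forall hbd)).trans (le_of_eq (liminf_const _))

/-- With `θ = 1/(2q)`, `W a b` is the geometric mean of `W^q b^r`, `W^q a^r` and `a^r b^r` with
weights `θ`, `θ` and `1 - 2θ`, hence at most their sum. For `W = W y`, `a = G (x - y)`, `b = G x`,
each of the three integrates over `(x, y)` to a product of two finite integrals, which is all that
Young's inequality needs here. -/
theorem mul_mul_le_add_rpow (W a b : ℝ≥0∞) {q r : ℝ} (hq : 1 ≤ q) (hr : r * (1 - 1 / (2 * q)) = 1) :
    W * a * b ≤ W ^ q * b ^ r + (a ^ r * b ^ r + W ^ q * a ^ r) := by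
  set θ := 1 / (2 * q) with hθ
  have hθ0 : 0 ≤ θ := by positivity
  have hθ1 : θ ≤ 1 / 2 := one_div_le_one_div_of_le (by norm_num) (by linarith)
  have hqθ : q * θ + q * θ = 1 := by rw [hθ]; field_simp; norm_num
  have hr0 : 0 ≤ r := by
    by_contra hneg
    push Not at hneg
    nlinarith
  have h12 : 0 ≤ 1 - 2 * θ := by linarith
  set S := W ^ q * b ^ r + (a ^ r * b ^ r + W ^ q * a ^ r) with hS
  have hX : W ^ q * b ^ r ≤ S := le_self_add
  have hZ : a ^ r * b ^ r ≤ S := le_self_add.trans le_add_self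
  have hY : W ^ q * a ^ r ≤ S := le_add_self.trans le_add_self
  have hS1 : S = S ^ θ * S ^ θ * S ^ (1 - 2 * θ) := by
    rw [← ENNReal.rpow_add_of_nonneg _ _ hθ0 hθ0,
      ← ENNReal.rpow_add_of_nonneg _ _ (by linarith) h12]
    conv_lhs => rw [← ENNReal.rpow_one S]
    congr 1
    ring
  have hE : W * a * b = (W ^ q * b ^ r) ^ θ * (W ^ q * a ^ r) ^ θ * (a ^ r * b ^ r) ^ (1 - 2 * θ) := by
    rw [ENNReal.mul_rpow_of_nonneg _ _ hθ0, ENNReal.mul_rpow_of_nonneg _ _ hθ0,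
      ENNReal.mul_rpow_of_nonneg _ _ h12]
    simp only [← ENNReal.rpow_mul]
    have hc : ∀ c : ℝ≥0∞, c ^ (r * θ) * c ^ (r * (1 - 2 * θ)) = c := fun c => by
      rw [← ENNReal.rpow_add_of_nonneg _ _ (by positivity) (mul_nonneg hr0 h12)]
      conv_rhs => rw [← ENNReal.rpow_one c]
      congr 1
      linarith
    have hW : W ^ (q * θ) * W ^ (q * θ) = W := by
      rw [← ENNReal.rpow_add_of_nonneg _ _ (by positivity) (by positivity), hqθ,
        ENNReal.rpow_one]
    calc W * a * b = (W ^ (q * θ) * W ^ (q * θ)) * (a ^ (r * θ) * a ^ (r * (1 - 2 * θ))) *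
          (b ^ (r * θ) * b ^ (r * (1 - 2 * θ))) := by rw [hW, hc, hc]
      _ = _ := by ring
  rw [hE, hS1]
  gcongr

/-- A qualitative form of Young's inequality for convolutions. -/
theorem lintegral_lconvolution_mul_lt_top {W G : Eucl N → ℝ≥0∞} (hW : AEMeasurable W volume)
    (hG : AEMeasurable G volume) {q r : ℝ} (hq : 1 ≤ q) (hr : r * (1 - 1 / (2 * q)) = 1)
    (hWq : ∫⁻ x, W x ^ q < ⊤) (hGr : ∫⁻ x, G x ^ r < ⊤) :
    ∫⁻ x, lconvolution W G volume x * G x < ⊤ := by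
  have hGx : ∀ x, AEMeasurable (fun y => G (-y + x)) volume := fun x => by
    simp only [neg_add_eq_sub]
    exact hG.comp_quasiMeasurePreserving
      (Measure.measurePreserving_sub_left volume x).quasiMeasurePreserving
  have hGi : ∀ x, ∫⁻ y, G (-y + x) ^ r = ∫⁻ y, G y ^ r := fun x => by
    simp only [neg_add_eq_sub]
    exact lintegral_sub_left_eq_self (fun y => G y ^ r) x
  have hpt : ∀ x, lconvolution W G volume x * G x ≤ (∫⁻ y, W y ^ q) * G x ^ r +
      ((∫⁻ y, G y ^ r) * G x ^ r + lconvolution (fun y => W y ^ q) (fun y => G y ^ r) volume x) := by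
    intro x
    have e1 : lconvolution W G volume x * G x = ∫⁻ y, W y * G (-y + x) * G x := by
      have hm : AEMeasurable (fun y => W y * G (-y + x)) volume := hW.mul (hGx x)
      rw [lconvolution_def, lintegral_mul_const'' _ hm]
    rw [e1]
    refine (lintegral_mono fun y => mul_mul_le_add_rpow (W y) (G (-y + x)) (G x) hq hr).trans ?_
    rw [lintegral_add_left' ((hW.pow_const q).mul_const _),
      lintegral_add_left' (((hGx x).pow_const r).mul_const _),
      lintegral_mul_const'' _ (hW.pow_const q), lintegral_mul_const'' _ ((hGx x).pow_const r), hGi,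
      lconvolution_def]
  refine (lintegral_mono hpt).trans_lt ?_
  rw [lintegral_add_left' ((hG.pow_const r).const_mul _),
    lintegral_add_left' ((hG.pow_const r).const_mul _),
    lintegral_const_mul'' _ (hG.pow_const r), lintegral_const_mul'' _ (hG.pow_const r)]
  refine ENNReal.add_lt_top.2 ⟨ENNReal.mul_lt_top hWq hGr,
    ENNReal.add_lt_top.2 ⟨ENNReal.mul_lt_top hGr hGr, ?_⟩⟩
  have hprod : AEMeasurable (fun z : Eucl N × Eucl N => G (-z.2 + z.1)) (volume.prod volume) := by
    simp only [neg_add_eq_sub]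
    exact hG.comp_quasiMeasurePreserving (quasiMeasurePreserving_sub volume volume)
  calc ∫⁻ x, lconvolution (fun y => W y ^ q) (fun y => G y ^ r) volume x
      = ∫⁻ x, ∫⁻ y, W y ^ q * G (-y + x) ^ r := rfl
    _ = ∫⁻ y, ∫⁻ x, W y ^ q * G (-y + x) ^ r :=
        lintegral_lintegral_swap (((hW.pow_const q).comp_quasiMeasurePreserving
          Measure.quasiMeasurePreserving_snd).mul (hprod.pow_const r))
    _ = ∫⁻ y, W y ^ q * ∫⁻ x, G x ^ r := by
        refine lintegral_congr fun y => ?_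
        rw [lintegral_add_left_eq_self (fun x => W y ^ q * G x ^ r) (-y),
          lintegral_const_mul'' _ (hG.pow_const r)]
    _ = (∫⁻ y, W y ^ q) * ∫⁻ x, G x ^ r := lintegral_mul_const'' _ (hW.pow_const q)
    _ < ⊤ := ENNReal.mul_lt_top hWq hGr

end Embedding

/-! ### Smooth truncation of real values. -/

section Truncation

/-- A smooth bounded truncation of the identity, at height `1 / a`. -/
def trunc (a t : ℝ) : ℝ := t / Real.sqrt (1 + (a * t) ^ 2)

theorem sqrt_one_add_sq_pos (s : ℝ) : 0 < Real.sqrt (1 + s ^ 2) :=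
  Real.sqrt_pos.2 (by positivity)

theorem one_le_sqrt_one_add_sq (s : ℝ) : 1 ≤ Real.sqrt (1 + s ^ 2) :=
  Real.one_le_sqrt.2 (by nlinarith [sq_nonneg s])

theorem contDiff_trunc (a : ℝ) : ContDiff ℝ ∞ (trunc a) := by
  refine contDiff_id.div ?_ fun t => (sqrt_one_add_sq_pos _).ne'
  refine ContDiff.sqrt (by fun_prop) fun t => by positivity

theorem hasDerivAt_trunc (a t : ℝ) :
    HasDerivAt (trunc a) (1 / Real.sqrt (1 + (a * t) ^ 2) ^ 3) t := by
  have hs := sqrt_one_add_sq_pos (a * t)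
  have hsq : Real.sqrt (1 + (a * t) ^ 2) ^ 2 = 1 + (a * t) ^ 2 := Real.sq_sqrt (by positivity)
  have h1 : HasDerivAt (fun t : ℝ => 1 + (a * t) ^ 2) (2 * (a * t) * a) t := by
    have := (((hasDerivAt_id t).const_mul a).pow 2).const_add 1
    simpa [Pi.pow_def] using this
  have h2 := (hasDerivAt_id t).div (h1.sqrt (by positivity)) hs.ne'
  have h3 : HasDerivAt (trunc a) _ t := h2
  convert h3 using 1
  simp only [id]
  set s := Real.sqrt (1 + (a * t) ^ 2)
  field_simp
  linear_combination -hsq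

theorem abs_trunc_le_abs (a t : ℝ) : |trunc a t| ≤ |t| := by
  rw [trunc, abs_div, abs_of_pos (sqrt_one_add_sq_pos _)]
  exact div_le_self (abs_nonneg t) (one_le_sqrt_one_add_sq _)

theorem abs_trunc_le {a : ℝ} (ha : 0 < a) (t : ℝ) : |trunc a t| ≤ 1 / a := by
  rw [trunc, abs_div, abs_of_pos (sqrt_one_add_sq_pos _), div_le_div_iff₀ (sqrt_one_add_sq_pos _) ha,
    one_mul]
  refine Real.le_sqrt_of_sq_le ?_
  rw [mul_pow, sq_abs]
  nlinarith

theorem abs_deriv_trunc_le (a t : ℝ) : |1 / Real.sqrt (1 + (a * t) ^ 2) ^ 3| ≤ 1 := by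
  have h := one_le_pow₀ (one_le_sqrt_one_add_sq (a * t)) (n := 3)
  rw [abs_of_nonneg (by positivity), div_le_one (by linarith)]
  exact h

theorem tendsto_sqrt_trunc {a : ℕ → ℝ} (ha : Tendsto a atTop (𝓝 0)) (t : ℝ) :
    Tendsto (fun n => Real.sqrt (1 + (a n * t) ^ 2)) atTop (𝓝 1) := by
  have h := (((ha.mul_const t).pow 2).const_add 1).sqrt
  simpa using h

end Truncation

/-! ### From the duality product to integrals, and the one-sided Fatou argument. -/

section Duality

variable {N : ℕ}

theorem integrable_mul_of_bounded {f φ : Eucl N → ℝ} (hf : LocallyIntegrable f volume)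
    (hm : AEStronglyMeasurable φ volume) (hc : HasCompactSupport φ) {B : ℝ}
    (hB : ∀ x, ‖φ x‖ ≤ B) : Integrable (fun x => f x * φ x) volume := by
  have hK : IsCompact (tsupport φ) := hc
  refine (integrableOn_iff_integrable_of_support_subset (s := tsupport φ) ?_).1 ?_
  · intro x hx
    exact subset_tsupport φ (right_ne_zero_of_mul hx)
  · exact (hf.integrableOn_isCompact hK).mul_bdd hm.restrict
      (Eventually.of_forall hB)

/-- For bounded test functions, the duality product is the integral. -/
theorem IsDualityProduct.eq_integral {f φ : Eucl N → ℝ} {G : Eucl N → Eucl N} {ℓ : ℝ}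
    (h : IsDualityProduct f φ ℓ) (hf : LocallyIntegrable f volume) (hφ : HasWeakGradient φ G)
    (hφ2 : MemLp φ 2 volume) (hG : MemLp G 2 volume) (hc : HasCompactSupport φ) {B : ℝ}
    (hB : ∀ x, ‖φ x‖ ≤ B) : ∫ x, f x * φ x = ℓ := by
  have hK : IsCompact (Metric.cthickening 2 (tsupport φ)) := IsCompact.cthickening hc
  have hsub : ∀ n, tsupport (mollify n φ) ⊆ Metric.cthickening 2 (tsupport φ) := fun n =>
    tsupport_mollify_subset n φ
  -- Mollifications are admissible approximants for the duality product. They inherit the bound `B`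
  -- and a common compact support, so `∫ f ψₙ` also converges to the plain integral.
  have h1 := h (fun n => mollify n φ) _ hK
    (fun n => ⟨⟨mollify_contDiff n hφ.1, hK.of_isClosed_subset (isClosed_tsupport _) (hsub n)⟩,
      hsub n⟩) (h1Norm_mollify_sub_tendsto_zero hφ hφ2 hG)
  refine tendsto_nhds_unique ?_ h1
  have hB0 : 0 ≤ B := (norm_nonneg _).trans (hB 0)
  refine tendsto_integral_of_dominated_convergence
    (fun x => B * ‖(Metric.cthickening 2 (tsupport φ)).indicator f x‖) (fun n => ?_) ?_
    (fun n => Eventually.of_forall fun x => ?_) ?_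
  · exact hf.aestronglyMeasurable.mul (mollify_contDiff n hφ.1).continuous.aestronglyMeasurable
  · exact (((hf.integrableOn_isCompact hK).integrable_indicator hK.measurableSet).norm).const_mul B
  · by_cases hx : x ∈ Metric.cthickening 2 (tsupport φ)
    · rw [Set.indicator_of_mem hx, norm_mul, mul_comm]
      gcongr
      exact norm_mollify_le n hB x
    · have : mollify n φ x = 0 := by
        by_contra h0
        exact hx (hsub n (subset_tsupport _ h0))
      rw [this, mul_zero, norm_zero]
      positivity
  · filter_upwards [mollify_tendsto_ae hφ.1] with x hx
    exact hx.const_mul _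

/-- Fatou's lemma for a function bounded above by an integrable one, multiplied by weights that
tend to one. -/
theorem integrable_of_tendsto_integral_mul {α : Type*} [MeasurableSpace α] {μ : Measure α}
    {S H : α → ℝ} {θ : ℕ → α → ℝ} {L : ℝ} (hS : AEStronglyMeasurable S μ) (hH : Integrable H μ)
    (hH0 : ∀ x, 0 ≤ H x) (hSH : ∀ᵐ x ∂μ, S x ≤ H x) (hθ0 : ∀ n x, 0 ≤ θ n x)
    (hθ1 : ∀ n x, θ n x ≤ 1) (hθ : ∀ x, Tendsto (fun n => θ n x) atTop (𝓝 1))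
    (hint : ∀ n, Integrable (fun x => S x * θ n x) μ)
    (hL : Tendsto (fun n => ∫ x, S x * θ n x ∂μ) atTop (𝓝 L)) :
    Integrable S μ ∧ ∫ x, S x ∂μ = L := by
  -- Where `S ≥ 0` one has `S θₙ ≤ S ≤ H`; where `S ≤ 0` one has `S θₙ ≤ 0 ≤ H`.
  have hpos : ∀ n, ∀ᵐ x ∂μ, 0 ≤ H x - S x * θ n x := fun n => by
    filter_upwards [hSH] with x hx
    rcases le_total 0 (S x) with h | h
    · nlinarith [mul_le_of_le_one_right h (hθ1 n x)]
    · nlinarith [mul_nonpos_of_nonpos_of_nonneg h (hθ0 n x), hH0 x]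
  have hfat : ∫⁻ x, ENNReal.ofReal (H x - S x) ∂μ ≤
      liminf (fun n => ∫⁻ x, ENNReal.ofReal (H x - S x * θ n x) ∂μ) atTop := by
    refine le_trans (le_of_eq ?_) (lintegral_liminf_le' fun n =>
      (hH.sub (hint n)).aestronglyMeasurable.aemeasurable.ennreal_ofReal)
    refine lintegral_congr fun x => ?_
    have h1 := ((hθ x).const_mul (S x)).const_sub (H x)
    rw [mul_one] at h1
    exact ((ENNReal.continuous_ofReal.tendsto _).comp h1).liminf_eq.symm
  have hlim : Tendsto (fun n => ∫⁻ x, ENNReal.ofReal (H x - S x * θ n x) ∂μ) atTop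
      (𝓝 (ENNReal.ofReal (∫ x, H x ∂μ - L))) := by
    have h1 := (ENNReal.continuous_ofReal.tendsto _).comp (hL.const_sub (∫ x, H x ∂μ))
    refine h1.congr fun n => ?_
    simp only [Function.comp]
    rw [← integral_sub hH (hint n)]
    exact ofReal_integral_eq_lintegral_ofReal (hH.sub (hint n)) (hpos n)
  rw [hlim.liminf_eq] at hfat
  -- Fatou's lemma bounds `∫ (H - S)` by the finite number `∫ H - L`. Once `S` is integrable, `|S|`
  -- dominates every `S θₙ`.
  have hHS : Integrable (fun x => H x - S x) μ := by
    refine ⟨hH.1.sub hS, ?_⟩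
    rw [hasFiniteIntegral_iff_ofReal (by filter_upwards [hSH] with x hx using sub_nonneg.2 hx)]
    exact hfat.trans_lt ENNReal.ofReal_lt_top
  have hSi : Integrable S μ := (hH.sub hHS).congr (Eventually.of_forall fun x => by simp)
  refine ⟨hSi, tendsto_nhds_unique ?_ hL⟩
  refine tendsto_integral_of_dominated_convergence (fun x => ‖S x‖) (fun n => (hint n).1) hSi.norm
    (fun n => Eventually.of_forall fun x => ?_) (Eventually.of_forall fun x => ?_)
  · rw [norm_mul, Real.norm_of_nonneg (hθ0 n x)]
    exact mul_le_of_le_one_right (norm_nonneg _) (hθ1 n x)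
  · simpa using (hθ x).const_mul (S x)

end Duality

/-! ### The admissible test functions built from `u`, and the limit of the left-hand side. -/

section Testing

variable {N : ℕ}

/-- The cut off and truncated solution. -/
def truncCutoff (n : ℕ) (u : Eucl N → ℝ) : Eucl N → ℝ :=
  fun x => cutoff N n x * trunc (1 / ((n : ℝ) + 1)) (u x)

/-- The weak gradient of `truncCutoff n u` when `g` is that of `u`. -/
def truncCutoffGrad (n : ℕ) (u : Eucl N → ℝ) (g : Eucl N → Eucl N) : Eucl N → Eucl N :=
  fun x => cutoff N n x • ((1 / Real.sqrt (1 + (1 / ((n : ℝ) + 1) * u x) ^ 2) ^ 3) • g x) +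
    trunc (1 / ((n : ℝ) + 1)) (u x) • gradient (cutoff N n) x

variable {u : Eucl N → ℝ} {g : Eucl N → Eucl N}

theorem HasWeakGradient.truncCutoff (h : HasWeakGradient u g) (hg : MemLp g 2 volume) (n : ℕ) :
    HasWeakGradient (truncCutoff n u) (truncCutoffGrad n u g) :=
  (h.comp hg (contDiff_trunc _) (hasDerivAt_trunc _) (abs_trunc_le (by positivity))
    (abs_deriv_trunc_le _)).mul_smooth (isTest_cutoff n).1

theorem abs_truncCutoff_le (n : ℕ) (u : Eucl N → ℝ) (x : Eucl N) : |truncCutoff n u x| ≤ |u x| := by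
  rw [truncCutoff, abs_mul, abs_of_nonneg (cutoff_nonneg n x)]
  exact (mul_le_of_le_one_left (abs_nonneg _) (cutoff_le_one n x)).trans (abs_trunc_le_abs _ _)

theorem norm_truncCutoff_le (n : ℕ) (u : Eucl N → ℝ) (x : Eucl N) :
    ‖truncCutoff n u x‖ ≤ 1 / (1 / ((n : ℝ) + 1)) := by
  rw [truncCutoff, Real.norm_eq_abs, abs_mul, abs_of_nonneg (cutoff_nonneg n x)]
  exact (mul_le_of_le_one_left (abs_nonneg _) (cutoff_le_one n x)).trans
    (abs_trunc_le (by positivity) _)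

theorem hasCompactSupport_truncCutoff (n : ℕ) (u : Eucl N → ℝ) :
    HasCompactSupport (truncCutoff n u) := (isTest_cutoff n).2.mul_right

/-- The bound does not depend on `n`: it provides the majorant when passing to the limit in the
energy. -/
theorem norm_truncCutoffGrad_le {C : ℝ} (hC0 : 0 ≤ C)
    (hC : ∀ (n : ℕ) (x : Eucl N), ‖gradient (cutoff N n) x‖ ≤ 1 / ((n : ℝ) + 1) * C)
    (n : ℕ) (x : Eucl N) : ‖truncCutoffGrad n u g x‖ ≤ ‖g x‖ + C * |u x| := by
  refine (norm_add_le _ _).trans (add_le_add ?_ ?_)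
  · rw [norm_smul, norm_smul, Real.norm_of_nonneg (cutoff_nonneg n x)]
    refine (mul_le_of_le_one_left (by positivity) (cutoff_le_one n x)).trans ?_
    exact mul_le_of_le_one_left (norm_nonneg _) (abs_deriv_trunc_le _ _)
  · rw [norm_smul, mul_comm, Real.norm_eq_abs]
    refine mul_le_mul ((hC n x).trans (mul_le_of_le_one_left hC0 ?_)) (abs_trunc_le_abs _ _)
      (abs_nonneg _) hC0
    rw [div_le_one (by positivity)]
    have : (0 : ℝ) ≤ n := by positivity
    linarith

theorem HasWeakGradient.memLp_truncCutoffGrad (h : HasWeakGradient u g) (hu : MemLp u 2 volume)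
    (hg : MemLp g 2 volume) (n : ℕ) : MemLp (truncCutoffGrad n u g) 2 volume := by
  obtain ⟨C, hC0, hC⟩ := exists_norm_gradient_cutoff_le N
  refine (hg.norm.add (hu.norm.const_mul C)).of_le (h.truncCutoff hg n).2.1.aestronglyMeasurable
    (Eventually.of_forall fun x => (norm_truncCutoffGrad_le hC0 hC n x).trans ?_)
  exact le_abs_self _

theorem HasWeakGradient.memLp_truncCutoff (h : HasWeakGradient u g) (hu : MemLp u 2 volume)
    (hg : MemLp g 2 volume) (n : ℕ) : MemLp (Choquard.truncCutoff n u) 2 volume :=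
  hu.of_le (h.truncCutoff hg n).1.aestronglyMeasurable
    (Eventually.of_forall fun x => abs_truncCutoff_le n u x)

theorem tendsto_trunc (t : ℝ) :
    Tendsto (fun n : ℕ => trunc (1 / ((n : ℝ) + 1)) t) atTop (𝓝 t) := by
  have h := (tendsto_const_nhds (x := t)).div
    (tendsto_sqrt_trunc tendsto_one_div_add_atTop_nhds_zero_nat t) one_ne_zero
  rwa [div_one] at h

theorem tendsto_truncCutoff (u : Eucl N → ℝ) (x : Eucl N) :
    Tendsto (fun n => truncCutoff n u x) atTop (𝓝 (u x)) := by
  have h := (cutoff_tendsto x).mul (tendsto_trunc (u x))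
  rwa [one_mul] at h

theorem tendsto_truncCutoffGrad (u : Eucl N → ℝ) (g : Eucl N → Eucl N) (x : Eucl N) :
    Tendsto (fun n => truncCutoffGrad n u g x) atTop (𝓝 (g x)) := by
  obtain ⟨C, -, hC⟩ := exists_norm_gradient_cutoff_le N
  have hgr : Tendsto (fun n => gradient (cutoff N n) x) atTop (𝓝 0) := by
    refine squeeze_zero_norm (fun n => hC n x) ?_
    simpa using (tendsto_one_div_add_atTop_nhds_zero_nat (𝕜 := ℝ)).mul_const C
  have hs := (tendsto_const_nhds (x := (1 : ℝ))).div
    ((tendsto_sqrt_trunc tendsto_one_div_add_atTop_nhds_zero_nat (u x)).pow 3) (by norm_num)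
  have h := ((cutoff_tendsto x).smul (hs.smul_const (g x))).add ((tendsto_trunc (u x)).smul hgr)
  simpa [truncCutoffGrad] using h

theorem HasWeakGradient.tendsto_integral_truncCutoff (h : HasWeakGradient u g)
    (hu : MemLp u 2 volume) (hg : MemLp g 2 volume) :
    Tendsto (fun n => ∫ x, (inner ℝ (g x) (truncCutoffGrad n u g x) +
      u x * Choquard.truncCutoff n u x)) atTop (𝓝 (∫ x, (‖g x‖ ^ 2 + |u x| ^ 2))) := by
  obtain ⟨C, hC0, hC⟩ := exists_norm_gradient_cutoff_le N
  have hg2 : Integrable (fun x => ‖g x‖ ^ 2) volume := hg.integrable_norm_pow two_ne_zero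
  have hu2 : Integrable (fun x => |u x| ^ 2) volume := hu.integrable_norm_pow two_ne_zero
  refine tendsto_integral_of_dominated_convergence
    -- The cross term `C |g| |u|` is absorbed by `2 |g| |u| ≤ |g|² + |u|²`.
    (fun x => (1 + C) * ‖g x‖ ^ 2 + (1 + C) * |u x| ^ 2) (fun n => ?_) ?_
    (fun n => Eventually.of_forall fun x => ?_) (Eventually.of_forall fun x => ?_)
  · exact (hg.1.inner (h.truncCutoff hg n).2.1.aestronglyMeasurable).add
      (hu.1.mul (h.truncCutoff hg n).1.aestronglyMeasurable)
  · exact (hg2.const_mul _).add (hu2.const_mul _)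
  · have h1 : |inner ℝ (g x) (truncCutoffGrad n u g x)| ≤ ‖g x‖ * (‖g x‖ + C * |u x|) :=
      (abs_real_inner_le_norm _ _).trans
        (mul_le_mul_of_nonneg_left (norm_truncCutoffGrad_le hC0 hC n x) (norm_nonneg _))
    have h2 : |u x * Choquard.truncCutoff n u x| ≤ |u x| * |u x| := by
      rw [abs_mul]
      exact mul_le_mul_of_nonneg_left (abs_truncCutoff_le n u x) (abs_nonneg _)
    rw [Real.norm_eq_abs]
    refine (abs_add_le _ _).trans ((add_le_add h1 h2).trans ?_)
    nlinarith [mul_nonneg hC0 (sq_nonneg (‖g x‖ - |u x|)), mul_nonneg hC0 (sq_nonneg ‖g x‖),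
      mul_nonneg hC0 (sq_nonneg |u x|)]
  · have h1 := ((tendsto_const_nhds (x := g x)).inner (tendsto_truncCutoffGrad u g x) (𝕜 := ℝ)).add
      ((tendsto_truncCutoff u x).const_mul (u x))
    rw [real_inner_self_eq_norm_sq, ← sq, ← sq_abs (u x)] at h1
    exact h1

end Testing

/-! ### Pointwise relations between the potentials of `V`, `V⁺` and `|V|`. -/

section Nonlinearity

variable {N : ℕ}

theorem enorm_rpow_eq_ofReal (a : ℝ) {p : ℝ} (hp : 0 ≤ p) : ‖a‖ₑ ^ p = ENNReal.ofReal (|a| ^ p) := by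
  rw [Real.enorm_eq_ofReal_abs, ENNReal.ofReal_rpow_of_nonneg (abs_nonneg a) hp]

theorem abs_rpow_eq_mul_mul (a : ℝ) {p : ℝ} (hp : 0 < p) : |a| ^ (p - 2) * a * a = |a| ^ p := by
  -- For `p = 2` the power at `a = 0` is `0 ^ 0 = 1`, and the factors `a` make the product vanish.
  rcases eq_or_ne a 0 with rfl | ha
  · simp [Real.zero_rpow hp.ne']
  · have h := Real.rpow_add (abs_pos.2 ha) (p - 2) 2
    rw [sub_add_cancel, Real.rpow_two, sq_abs] at h
    rw [h]
    ring

theorem lconvolution_eq_ofReal {W u : Eucl N → ℝ} {p : ℝ} (hp : 0 ≤ p) {x : Eucl N}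
    (h : Integrable (fun t => W t * |u (x - t)| ^ p) volume) :
    lconvolution (fun y => ‖W y‖ₑ) (fun y => ‖u y‖ₑ ^ p) volume x =
      ENNReal.ofReal (∫ t, |W t| * |u (x - t)| ^ p) := by
  have e : ∀ t, |W t| * |u (x - t)| ^ p = ‖W t * |u (x - t)| ^ p‖ := fun t => by
    rw [norm_mul, Real.norm_eq_abs, Real.norm_of_nonneg (by positivity)]
  simp only [e]
  rw [ofReal_integral_norm_eq_lintegral_enorm h, lconvolution_def]
  refine lintegral_congr fun t => ?_
  rw [neg_add_eq_sub, enorm_rpow_eq_ofReal _ hp, enorm_mul,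
    Real.enorm_of_nonneg (by positivity : 0 ≤ |u (x - t)| ^ p)]

/-- `I` is the potential of `V⁺`, whose integral converges because that of `V` does absolutely. The
claims integrate `V ≤ V⁺` and `|V| = 2V⁺ - V`. -/
theorem potential_le_and_lconvolution_eq {V u : Eucl N → ℝ} {p : ℝ} (hp : 0 ≤ p)
    {x : Eucl N}
    (h : ConvolutionExistsAt V (fun y => |u y| ^ p) x (ContinuousLinearMap.mul ℝ ℝ) volume) :
    ∃ I : ℝ, 0 ≤ I ∧ potential V p u x ≤ I ∧
      lconvolution (fun y => ‖max (V y) 0‖ₑ) (fun y => ‖u y‖ₑ ^ p) volume x = ENNReal.ofReal I ∧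
      lconvolution (fun y => ‖V y‖ₑ) (fun y => ‖u y‖ₑ ^ p) volume x =
        ENNReal.ofReal (2 * I - potential V p u x) := by
  have hVw : Integrable (fun t => V t * |u (x - t)| ^ p) volume := h
  have hpw : Integrable (fun t => max (V t) 0 * |u (x - t)| ^ p) volume := by
    have : (fun t => max (V t) 0 * |u (x - t)| ^ p) = fun t => max (V t * |u (x - t)| ^ p) 0 := by
      ext t
      rw [max_mul_of_nonneg _ _ (by positivity), zero_mul]
    rw [this]
    exact hVw.pos_part
  have hpot : potential V p u x = ∫ t, V t * |u (x - t)| ^ p := rfl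
  refine ⟨∫ t, max (V t) 0 * |u (x - t)| ^ p, integral_nonneg fun t => by positivity, ?_, ?_, ?_⟩
  · rw [hpot]
    refine integral_mono hVw hpw fun t => ?_
    exact mul_le_mul_of_nonneg_right (le_max_left _ _) (by positivity)
  · rw [lconvolution_eq_ofReal hp hpw]
    simp only [abs_of_nonneg (le_max_right _ (0 : ℝ))]
  · rw [lconvolution_eq_ofReal hp hVw, hpot, ← integral_const_mul,
      ← integral_sub (hpw.const_mul 2) hVw]
    congr 1
    refine integral_congr_ae (Eventually.of_forall fun t => ?_)
    simp only
    rcases le_total 0 (V t) with hv | hv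
    · rw [abs_of_nonneg hv, max_eq_left hv]
      ring
    · rw [abs_of_nonpos hv, max_eq_right hv]
      ring

end Nonlinearity

end Choquard

end

/-! ### The energy identity. -/

theorem lemma3p2 (N : ℕ) (hN : 1 ≤ N) (p q : ℝ) (hp : 2 ≤ p) (hq : 1 ≤ q)
    (hpq : 1 / 2 - 1 / (N : ℝ) ≤ 1 / p * (1 - 1 / (2 * q)))
    (V : Choquard.Eucl N → ℝ) (hV : AEStronglyMeasurable V volume)
    (hVq : MemLp (fun x => max (V x) 0) (ENNReal.ofReal q) volume)
    (u : Choquard.Eucl N → ℝ) (hu : Choquard.MemH1 u)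
    (hsol : Choquard.IsWeakSolution V p u) :
    (∫⁻ x, lconvolution (fun y => ‖V y‖ₑ) (fun y => ‖u y‖ₑ ^ p) volume x * ‖u x‖ₑ ^ p) < ⊤ ∧
    ∫ x, Choquard.potential V p u x * |u x| ^ p
      = ∫ x, (‖Choquard.weakGrad u x‖ ^ 2 + |u x| ^ 2) := by
  open Choquard in
  obtain ⟨hu2, ⟨g', hg'⟩, hg2⟩ := hu
  obtain ⟨-, hconv, ⟨hfloc, -⟩, hweak⟩ := hsol
  have hg := hg'.weakGrad
  set g := weakGrad u with hgdef
  have hp0 : 0 < p := by linarith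
  have hq0 : 0 < q := by linarith
  have hum : AEMeasurable (fun x => ‖u x‖ₑ ^ p) volume := hu2.1.enorm.pow_const p
  -- integrability of the contribution of the positive part
  set r : ℝ := (1 - 1 / (2 * q))⁻¹ with hr
  have hθ : 1 / (2 * q) ≤ 1 / 2 := one_div_le_one_div_of_le (by norm_num) (by linarith)
  have hθ0 : 0 < 1 / (2 * q) := by positivity
  have hr1 : r * (1 - 1 / (2 * q)) = 1 := inv_mul_cancel₀ (by linarith)
  have hr1' : 1 ≤ r := one_le_inv₀ (by linarith) |>.2 (by linarith)
  have hGr : ∫⁻ x, (‖u x‖ₑ ^ p) ^ r < ⊤ := by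
    simp only [← ENNReal.rpow_mul]
    refine hg.lintegral_rpow_lt_top hN (by nlinarith) ?_ hu2 hg2
    refine hpq.trans (le_of_eq ?_)
    rw [hr, one_div (p * _), mul_inv, inv_inv, one_div p]
  have hWq : ∫⁻ x, ‖max (V x) 0‖ₑ ^ q < ⊤ := by
    have := lintegral_rpow_enorm_lt_top_of_eLpNorm_lt_top
      (by simpa using hq0) ENNReal.ofReal_ne_top hVq.2
    simpa [ENNReal.toReal_ofReal hq0.le] using this
  have hfin := lintegral_lconvolution_mul_lt_top hVq.1.enorm hum hq hr1 hWq hGr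
  set h : Eucl N → ℝ≥0∞ := fun x =>
    lconvolution (fun y => ‖max (V y) 0‖ₑ) (fun y => ‖u y‖ₑ ^ p) volume x * ‖u x‖ₑ ^ p with hh
  have hhm : AEMeasurable h volume := (aemeasurable_lconvolution hVq.1.enorm hum).mul hum
  have hH : Integrable (fun x => (h x).toReal) volume :=
    integrable_toReal_of_lintegral_ne_top hhm hfin.ne
  set S : Eucl N → ℝ := fun x => potential V p u x * |u x| ^ p with hS
  have hSf : ∀ x, S x = nonlinearity V p u x * u x := fun x => by
    simp only [hS, nonlinearity]
    rw [← abs_rpow_eq_mul_mul (u x) hp0]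
    ring
  -- Measurability is read off from `S = f u`, with `f` locally integrable, rather than from the
  -- potential, whose integral need not converge where `u = 0`.
  have hSm : AEStronglyMeasurable S volume := by
    rw [funext hSf]
    exact hfloc.aestronglyMeasurable.mul hu2.1
  have hpt : ∀ᵐ x, S x ≤ (h x).toReal ∧
      lconvolution (fun y => ‖V y‖ₑ) (fun y => ‖u y‖ₑ ^ p) volume x * ‖u x‖ₑ ^ p =
        ENNReal.ofReal (2 * (h x).toReal - S x) := by
    filter_upwards [hconv] with x hx
    rcases eq_or_ne (u x) 0 with h0 | h0
    -- Where `u` vanishes, every term has the factor `|u|^p = 0`, whatever the value of the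
    -- potentials, even `⊤`.
    · simp [hh, hS, h0, ENNReal.zero_rpow_of_pos hp0, Real.zero_rpow hp0.ne']
    · obtain ⟨I, hI0, hI1, hI2, hI3⟩ := potential_le_and_lconvolution_eq hp0.le (hx h0)
      have hw : 0 ≤ |u x| ^ p := by positivity
      have e : (h x).toReal = I * |u x| ^ p := by
        simp only [hh]
        rw [hI2, enorm_rpow_eq_ofReal _ hp0.le, ← ENNReal.ofReal_mul hI0,
          ENNReal.toReal_ofReal (mul_nonneg hI0 hw)]
      rw [e, hI3, enorm_rpow_eq_ofReal _ hp0.le, ← ENNReal.ofReal_mul (by linarith)]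
      refine ⟨mul_le_mul_of_nonneg_right hI1 hw, ?_⟩
      congr 1
      simp only [hS]
      ring
  -- testing the equation with truncations of the solution
  set θ : ℕ → Eucl N → ℝ := fun n x =>
    cutoff N n x / Real.sqrt (1 + (1 / ((n : ℝ) + 1) * u x) ^ 2) with hθdef
  -- Since `trunc a t` is `t` times a weight in `(0, 1]`, the test function is `θₙ u`, and `f θₙ u =
  -- S θₙ`.
  have hSθ : ∀ n x, S x * θ n x = nonlinearity V p u x * truncCutoff n u x := fun n x => by
    rw [hSf]
    simp only [hθdef, truncCutoff, trunc]
    ring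
  have hwg := fun n => hg.truncCutoff hg2 n
  have hw2 := fun n => hg.memLp_truncCutoff hu2 hg2 n
  have hwg2 := fun n => hg.memLp_truncCutoffGrad hu2 hg2 n
  have hint : ∀ n, Integrable (fun x => S x * θ n x) volume := fun n => by
    simp only [hSθ]
    exact integrable_mul_of_bounded hfloc (hw2 n).1 (hasCompactSupport_truncCutoff n u)
      (norm_truncCutoff_le n u)
  have hval : ∀ n, ∫ x, S x * θ n x =
      ∫ x, (inner ℝ (g x) (truncCutoffGrad n u g x) + u x * truncCutoff n u x) := fun n => by
    simp only [hSθ]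
    rw [(hweak _ (memH1_of_hasWeakGradient (hwg n) (hw2 n) (hwg2 n))
      (hasCompactSupport_truncCutoff n u)).eq_integral hfloc (hwg n) (hw2 n) (hwg2 n)
      (hasCompactSupport_truncCutoff n u) (norm_truncCutoff_le n u)]
    refine integral_congr_ae ?_
    filter_upwards [(hwg n).weakGrad_ae_eq] with x hx
    rw [hx]
  obtain ⟨hSi, hSL⟩ := integrable_of_tendsto_integral_mul hSm hH (fun x => ENNReal.toReal_nonneg)
    (hpt.mono fun x hx => hx.1)
    (fun n x => div_nonneg (cutoff_nonneg n x) (Real.sqrt_nonneg _))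
    (fun n x => (div_le_self (cutoff_nonneg n x) (one_le_sqrt_one_add_sq _)).trans
      (cutoff_le_one n x))
    (fun x => by
      have h1 := (cutoff_tendsto x).div
        (tendsto_sqrt_trunc tendsto_one_div_add_atTop_nhds_zero_nat (u x)) one_ne_zero
      rwa [div_one] at h1)
    hint ((hg.tendsto_integral_truncCutoff hu2 hg2).congr fun n => (hval n).symm)
  refine ⟨?_, hSL⟩
  -- The integrand with `|V|` is almost everywhere `2H - S`, a combination of integrable functions.
  rw [lintegral_congr_ae (hpt.mono fun x hx => hx.2)]
  exact ((hH.const_mul 2).sub hSi).lintegral_lt_top
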